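/- **Conventions.** Cardinals are identified with initial ordinals. For a regular uncountable cardinal $\kappa$ and an infinite cardinal $\chi<\kappa$, let $E^\kappa_\chi:=\{\alpha<\kappa\mid \mathrm{cf}(\alpha)=\chi\}$, and let $[\kappa]^\kappa$ be the set of all subsets of $\kappa$ of size $\kappa$. A *partition of $E\subseteq\kappa$ into stationary sets* is a family of pairwise disjoint stationary subsets of $\kappa$ whose union is $E$. A *$\kappa$-Souslin tree* is a poset $(T,<_T)$ with $|T|=\kappa$, having no chains and no antichains (sets of pairwise incomparable elements) of size $\kappa$, such that for every $x\in T$ the set $\{y\in T\mid y<_T x\}$ is well-ordered by $<_T$; the order type of that set is the height $\mathrm{ht}(x)$. The tree is *$\chi$-complete* if every $<_T$-increasing sequence of elements of $T$ of length less than $\chi$ has an upper bound in $T$. It is *regressive* if there is a map $\rho$ from the nodes whose height is a nonzero limit ordinal to $T$ such that $\rho(x)<_T x$ for every such node $x$, and, for any two such nodes $x,y$ of the same height, if $\rho(x)<_T y$ and $\rho(y)<_T x$ then $x=y$. For a family $\mathcal S$ of stationary subsets of $\kappa$ and a cardinal $\theta$, the principle $\clubsuit_{AD}(\mathcal S,{<}\theta)$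 asserts that there is a sequence $\langle\mathcal A_\alpha\mid\alpha\in\bigcup\mathcal S\rangle$ of families of subsets of $\kappa$ such that: * for every limit $\alpha\in\bigcup\mathcal S$, $\mathcal A_\alpha$ is a nonempty family of pairwise disjoint cofinal subsets of $\alpha$; * for all distinct $A,A'\in\bigcup_{\alpha\in\bigcup\mathcal S}\mathcal A_\alpha$, $\sup(A\cap A')<\sup(A)$; * for every $\alpha\in\bigcup\mathcal S$, $|\mathcal A_\alpha|=\mathrm{cf}(\alpha)$; * for every $\mathcal B\subseteq[\kappa]^\kappa$ with $|\mathcal B|<\theta$ and every $S\in\mathcal S$, the set $\{\alpha\in S\mid \sup(A\cap B)=\alpha\text{ for all }A\in\mathcal A_\alpha\text{ and }B\in\mathcal B\}$ is stationary in $\kappa$. **Theorem A.** 1. For every infinite cardinal $\lambda$, if there exists a $\mathrm{cf}(\lambda)$-complete $\lambda^+$-Souslin tree, then $\clubsuit_{AD}(\mathcal S,{<}\mathrm{cf}(\lambda))$ holds for every partition $\mathcal S$ of $E^{\lambda^+}_{\mathrm{cf}(\lambda)}$ into stationary sets. 2. For every regular uncountable cardinal $\kappa$, if there exists a regressive $\kappa$-Souslin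 tree, then $\clubsuit_{AD}(\mathcal S,{<}\omega)$ holds for every partition $\mathcal S$ of $E^\kappa_\omega$ into stationary sets. -/

import Mathlib

open Cardinal Order Set

universe u

/-! ### Trees -/

/-- A poset in which the set of predecessors of every element is well-ordered. -/
class IsSetTree (T : Type u) [PartialOrder T] : Prop where
  isWellOrder_Iio : ∀ x : T, IsWellOrder (Iio x) (· < ·)

attribute [instance] IsSetTree.isWellOrder_Iio

/-- The height of a node: the order type of its set of strict predecessors. -/
noncomputable def treeHeight {T : Type u} [PartialOrder T] [IsSetTree T] (x : T) : Ordinal.{u} :=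
  Ordinal.type (fun a b : Iio x => a < b)

/-- `T` is a `κ`-Souslin tree: a tree of size `κ` with no chains and no antichains of size `κ`. -/
structure IsSouslinTree (κ : Cardinal.{u}) (T : Type u) [PartialOrder T] [IsSetTree T] : Prop where
  card_eq : #T = κ
  chain_card_ne : ∀ C : Set T, IsChain (· ≤ ·) C → #C ≠ κ
  antichain_card_ne : ∀ A : Set T, IsAntichain (· ≤ ·) A → #A ≠ κ

/-- Every strictly increasing sequence of elements of `T` of (ordinal) length less than `χ` has an
upper bound in `T`. -/
def IsCompleteTree (χ : Cardinal.{u}) (T : Type u) [PartialOrder T] : Prop :=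
  ∀ o : Ordinal.{u}, o < χ.ord → ∀ f : o.ToType → T, StrictMono f → BddAbove (range f)

/-- `T` is regressive. The values of `ρ` at nodes of non-limit height play no role. -/
def IsRegressiveTree (T : Type u) [PartialOrder T] [IsSetTree T] : Prop :=
  ∃ ρ : T → T,
    (∀ x : T, IsSuccLimit (treeHeight x) → ρ x < x) ∧
    ∀ x y : T, IsSuccLimit (treeHeight x) → treeHeight x = treeHeight y →
      ρ x < y → ρ y < x → x = y

/-! ### The guessing principle

A cardinal `κ` is represented by the well-ordered type `κ.ord.ToType`, whose elements are the
ordinals below `κ`. -/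

/-- The set `E^κ_χ` of all `α < κ` of cofinality `χ`. -/
def cofSet (κ χ : Cardinal.{u}) : Set κ.ord.ToType :=
  {α | Order.cof (Iio α) = χ}

/-- `A` is a cofinal subset of the ordinal `α` (that is, of the initial segment below `α`). -/
def IsCofinalSubset {K : Type u} [LinearOrder K] (A : Set K) (α : K) : Prop :=
  A ⊆ Iio α ∧ ∀ γ < α, ∃ β ∈ A, γ ≤ β

/-- `sup X < sup Y` for sets of ordinals: some upper bound of `X` lies strictly below some
element of `Y`. -/
def SupLT {K : Type u} [LinearOrder K] (X Y : Set K) : Prop :=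
  ∃ b ∈ upperBounds X, ∃ y ∈ Y, b < y

theorem supLT_iff_of_isLUB {K : Type u} [LinearOrder K] {X Y : Set K} {s t : K}
    (hs : IsLUB X s) (ht : IsLUB Y t) : SupLT X Y ↔ s < t := by
  constructor
  · rintro ⟨b, hb, y, hy, hby⟩
    exact ((hs.2 hb).trans_lt hby).trans_le (ht.1 hy)
  · intro h
    obtain ⟨y, hy, hsy, -⟩ := ht.exists_between h
    exact ⟨s, hs.1, y, hy, hsy⟩

/-- The restriction of `𝒜` to `S` is an AD-multi-ladder system. -/
structure IsADMultiLadderSystem {κ : Cardinal.{u}} (S : Set κ.ord.ToType)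
    (𝒜 : κ.ord.ToType → Set (Set κ.ord.ToType)) : Prop where
  nonempty : ∀ α ∈ S, IsSuccLimit α → (𝒜 α).Nonempty
  cofinal : ∀ α ∈ S, IsSuccLimit α → ∀ A ∈ 𝒜 α, IsCofinalSubset A α
  disjoint : ∀ α ∈ S, IsSuccLimit α → (𝒜 α).PairwiseDisjoint id
  almostDisjoint : ∀ A ∈ ⋃ α ∈ S, 𝒜 α, ∀ A' ∈ ⋃ α ∈ S, 𝒜 α, A ≠ A' → SupLT (A ∩ A') A

/-- The principle `♣_AD(𝒮, <θ)` for a family `𝒮` of stationary subsets of `κ`. -/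
def ClubAD (κ : Cardinal.{u}) (𝒮 : Set (Set κ.ord.ToType)) (θ : Cardinal.{u}) : Prop :=
  ∃ 𝒜 : κ.ord.ToType → Set (Set κ.ord.ToType),
    IsADMultiLadderSystem (⋃₀ 𝒮) 𝒜 ∧
    (∀ α ∈ ⋃₀ 𝒮, #(𝒜 α) = Order.cof (Iio α)) ∧
    ∀ ℬ : Set (Set κ.ord.ToType), (∀ B ∈ ℬ, #B = κ) → #ℬ < θ → ∀ S ∈ 𝒮,
      IsStationary {α | α ∈ S ∧ ∀ A ∈ 𝒜 α, ∀ B ∈ ℬ, IsLUB (A ∩ B) α}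

/-- `𝒮` is a partition of the subset `E` of `κ` into stationary sets. -/
structure IsStationaryPartition {κ : Cardinal.{u}} (𝒮 : Set (Set κ.ord.ToType))
    (E : Set κ.ord.ToType) : Prop where
  stationary : ∀ S ∈ 𝒮, IsStationary S
  disjoint : 𝒮.PairwiseDisjoint id
  sUnion_eq : ⋃₀ 𝒮 = E

/-! ### Clubs and stationary sets in a regular well-order -/

section Stationary

variable {K : Type u} [LinearOrder K]

/-! The ladders are traces of vanishing branches. Let χ be the relevant cofinality. Enumerate by κ,
with nondecreasing heights, the nodes of the tree lying on levels closed under a fixed splitting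
function. For α of cofinality χ whose enumerated heights have no maximum, let η be their supremum,
so cf(η) = χ. A branch through the levels below η that has no upper bound leaves a trace cofinal in
α. Two distinct such branches separate below the shorter length: if the shorter one were contained
in a longer one, a node of the latter would bound it. This yields almost disjointness. The remaining
α get ladders of order type χ inside a single level.

Vanishing branches are built in χ steps (`exists_isVanishingBranch`), arranging that every node of
level η fails to bound the result. In a cf(λ)-complete λ⁺-tree, level η is an increasing union of
cf(λ) sets of size less than λ, and one of λ incomparable extensions avoids a whole such set. In a
regressive tree, at most one x on level η satisfies ρ x < s < x, so one of two incomparable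
extensions of s avoids it.

Guessing rests on the Souslin property (`IsSouslinTree.exists_guess`). Given B of size κ there is a
node w above which B is everywhere large, and maximal antichain arguments show that on a club of α
every vanishing branch of length η through w meets B cofinally. It remains to guess w. There are at
most κ sets of fewer than χ nodes; each stationary set is split into stationary pieces indexed by
them, and each ladder at α includes tails of branches through all suitable nodes of the set assigned
to α. Recursion supplies χ pairwise disjoint ladders of this kind. -/

theorem exists_forall_lt_of_mk_lt_cof {s : Set K} (h : #s < cof K) : ∃ x, ∀ y ∈ s, y < x :=
  not_isCofinal_iff.1 fun hs => (cof_le hs).not_gt h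

theorem noMaxOrder_of_aleph0_lt_cof (hK : ℵ₀ < cof K) : NoMaxOrder K := by
  refine ⟨fun a => ?_⟩
  obtain ⟨x, hx⟩ := exists_forall_lt_of_mk_lt_cof (s := {a})
    (by rw [mk_singleton]; exact one_lt_aleph0.trans hK)
  exact ⟨x, hx a rfl⟩

theorem mk_Iic_lt_cof (hK : ℵ₀ < cof K) (hI : ∀ a : K, #(Iio a) < cof K) (a : K) :
    #(Iic a) < cof K := by
  have := noMaxOrder_of_aleph0_lt_cof hK
  obtain ⟨b, hb⟩ := exists_gt a
  exact (mk_le_mk_of_subset fun x (hx : x ≤ a) => hx.trans_lt hb).trans_lt (hI b)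

theorem isClub_Ioi [NoMaxOrder K] (a : K) : IsClub (Ioi a) := by
  refine ⟨?_, fun x => ?_⟩
  · intro s hs hs₀ _ x hx
    obtain ⟨y, hy⟩ := hs₀
    exact lt_of_lt_of_le (hs hy) (hx.1 hy)
  · obtain ⟨b, hb⟩ := exists_gt (max a x)
    exact ⟨b, (le_max_left _ _).trans_lt hb, ((le_max_right _ _).trans_lt hb).le⟩

variable [WellFoundedLT K]

theorem exists_isLUB_range_nat (hK : ℵ₀ < cof K) (a : ℕ → K) : ∃ x, IsLUB (range a) x := by
  obtain ⟨x, hx⟩ := exists_forall_lt_of_mk_lt_cof (s := range a)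
    ((mk_le_aleph0_iff.2 (countable_range a).to_subtype).trans_lt hK)
  have hne : (upperBounds (range a)).Nonempty := ⟨x, fun y hy => (hx y hy).le⟩
  exact ⟨_, WellFounded.min_mem wellFounded_lt _ hne,
    fun y hy => le_of_not_gt fun h => WellFounded.not_lt_min wellFounded_lt _ hy h⟩

/-- For unboundedness, iterate ω times, each time entering all clubs indexed up to the current
point; a tail of the sequence lies in any given `C γ` with γ below the limit. -/
theorem isClub_diagonal_inter (hK : ℵ₀ < cof K) (hI : ∀ a : K, #(Iio a) < cof K)
    {C : K → Set K} (hC : ∀ a, IsClub (C a)) : IsClub {α | ∀ γ < α, α ∈ C γ} := by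
  have := noMaxOrder_of_aleph0_lt_cof hK
  refine ⟨?_, fun a => ?_⟩
  · intro s hs hs₀ _ x hx γ hγ
    obtain ⟨y, hy, hγy⟩ : ∃ y ∈ s, γ < y := by
      by_contra! h
      exact (hx.2 h).not_gt hγ
    refine (hC γ).isLUB_mem (t := s ∩ Ici y) ?_ ⟨y, hy, le_rfl⟩ ⟨?_, ?_⟩
    · exact fun z hz => hs hz.1 γ (hγy.trans_le hz.2)
    · exact fun z hz => hx.1 hz.1
    · intro b hb
      refine hx.2 fun z hz => ?_
      rcases le_total z y with h | h
      · exact h.trans (hb ⟨hy, le_rfl⟩)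
      · exact hb ⟨hz, h⟩
  · have step : ∀ x : K, ∃ y, x < y ∧ ∀ γ ≤ x, y ∈ C γ := by
      intro x
      have h : IsClub (⋂ γ : Iic x, C γ) :=
        IsClub.iInter hK.ne' (by simpa using mk_Iic_lt_cof hK hI x) fun γ => hC γ
      obtain ⟨b, hb⟩ := exists_gt x
      obtain ⟨y, hy, hby⟩ := h.isCofinal b
      exact ⟨y, hb.trans_le hby, fun γ hγ => mem_iInter.1 hy ⟨γ, hγ⟩⟩
    choose f hf hfC using step
    let s : ℕ → K := fun n => f^[n] a
    have hs : ∀ n, s (n + 1) = f (s n) := fun n => Function.iterate_succ_apply' f n a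
    have hmono : StrictMono s := strictMono_nat_of_lt_succ fun n => by rw [hs]; exact hf _
    obtain ⟨x, hx⟩ := exists_isLUB_range_nat hK s
    refine ⟨x, fun γ hγ => ?_, hx.1 ⟨0, rfl⟩⟩
    obtain ⟨n, hn⟩ : ∃ n, γ < s n := by
      by_contra! h
      exact (hx.2 (by rintro _ ⟨n, rfl⟩; exact h n)).not_gt hγ
    refine (hC γ).isLUB_mem (t := range fun m => s (n + m + 1)) ?_ (range_nonempty _) ⟨?_, ?_⟩
    · rintro _ ⟨m, rfl⟩
      simp only [hs]
      exact hfC _ _ (hn.le.trans (hmono.monotone (Nat.le_add_right n m)))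
    · rintro _ ⟨m, rfl⟩
      exact hx.1 ⟨_, rfl⟩
    · intro b hb
      refine hx.2 ?_
      rintro _ ⟨m, rfl⟩
      exact (hmono.monotone (by omega)).trans (hb ⟨m, rfl⟩)

/-- The closure points of a function form a club. -/
theorem isClub_closure_points (hK : ℵ₀ < cof K) (hI : ∀ a : K, #(Iio a) < cof K) (g : K → K) :
    IsClub {α | ∀ β < α, g β < α} :=
  haveI := noMaxOrder_of_aleph0_lt_cof hK
  isClub_diagonal_inter hK hI (C := fun β => Ioi (g β)) fun β => isClub_Ioi (g β)

theorem IsStationary.inter_isClub (hK : ℵ₀ < cof K) {S C : Set K} (hS : IsStationary S)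
    (hC : IsClub C) : IsStationary (S ∩ C) := fun D hD => by
  rw [inter_assoc]
  exact hS (hC.inter hK.ne' hD)

/-- **Fodor's lemma**. -/
theorem IsStationary.exists_fiber_of_regressive (hK : ℵ₀ < cof K)
    (hI : ∀ a : K, #(Iio a) < cof K) {S : Set K} (hS : IsStationary S) {f : K → K}
    (hf : ∀ α ∈ S, f α < α) : ∃ γ, IsStationary {α | α ∈ S ∧ f α = γ} := by
  by_contra! h
  simp_rw [not_isStationary_iff] at h
  choose C hC hd using h
  obtain ⟨α, hα, hαC⟩ := hS (isClub_diagonal_inter hK hI hC)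
  exact disjoint_left.1 (hd (f α)) ⟨hα, rfl⟩ (hαC _ (hf α hα))

theorem mk_Iio_ordToType_lt {χ : Cardinal.{u}} (i : χ.ord.ToType) : #(Iio i) < χ := by
  simpa using mk_Iio_lt i (by simp)

/-- A well-order of cofinality `χ` has a strictly increasing cofinal `χ`-sequence. -/
theorem exists_strictMono_isCofinal_range {χ : Cardinal.{u}} (hχ : cof K = χ) :
    ∃ f : χ.ord.ToType → K, StrictMono f ∧ IsCofinal (range f) := by
  obtain ⟨s, hs, hst⟩ := Ordinal.exists_ord_cof_eq K
  rw [hχ, ← Ordinal.type_toType χ.ord] at hst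
  obtain ⟨φ⟩ := Ordinal.type_eq.1 hst
  refine ⟨fun i => φ.symm i, fun i j hij => φ.symm.map_rel_iff.2 hij, fun γ => ?_⟩
  obtain ⟨b, hb, hγb⟩ := hs γ
  exact ⟨b, ⟨φ ⟨b, hb⟩, by simp⟩, hγb⟩

/-- A point of cofinality `χ` is the limit of a `χ`-indexed strictly increasing sequence. -/
theorem exists_strictMono_cofinal {χ : Cardinal.{u}} {α : K} (hα : cof (Iio α) = χ) :
    ∃ f : χ.ord.ToType → K, StrictMono f ∧ (∀ i, f i < α) ∧ ∀ γ < α, ∃ i, γ ≤ f i := by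
  obtain ⟨f, hf, hfc⟩ := exists_strictMono_isCofinal_range hα
  refine ⟨fun i => f i, fun i j hij => hf hij, fun i => (f i).2, fun γ hγ => ?_⟩
  obtain ⟨_, ⟨i, rfl⟩, hi⟩ := hfc ⟨γ, hγ⟩
  exact ⟨i, hi⟩

/-- A stationary set of points of fixed cofinality `χ` splits into `cof K` many stationary sets. -/
theorem IsStationary.exists_splitting (hK : ℵ₀ < cof K) (hI : ∀ a : K, #(Iio a) < cof K)
    {χ : Cardinal.{u}} (hχ : χ < cof K) {S : Set K} (hS : IsStationary S)
    (hSχ : ∀ α ∈ S, cof (Iio α) = χ) {ι : Type u} [Nonempty ι] (hι : #ι ≤ cof K) :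
    ∃ g : K → ι, ∀ i, IsStationary {α | α ∈ S ∧ g α = i} := by
  classical
  have := noMaxOrder_of_aleph0_lt_cof hK
  have hlad : ∀ α : K, ∃ f : χ.ord.ToType → K,
      α ∈ S → (∀ i, f i < α) ∧ ∀ γ < α, ∃ i, γ ≤ f i := by
    intro α
    by_cases h : α ∈ S
    · obtain ⟨f, -, h1, h2⟩ := exists_strictMono_cofinal (hSχ α h)
      exact ⟨f, fun _ => ⟨h1, h2⟩⟩
    · exact ⟨fun _ => α, fun h' => absurd h' h⟩
  choose c hc using hlad
  -- Some coordinate of the ladders is stationarily often above every β. Otherwise a common bound β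
  -- of the χ many failures would make a stationary tail of S a union of χ many nonstationary sets.
  obtain ⟨j, hj⟩ : ∃ j, ∀ β, IsStationary {α | α ∈ S ∧ β ≤ c α j} := by
    by_contra! h
    choose b hb using h
    obtain ⟨β, hβ⟩ := exists_forall_lt_of_mk_lt_cof (s := range b)
      (mk_range_le.trans_lt (by simpa using hχ))
    have h1 := hS.inter_isClub hK (isClub_Ioi β)
    have h2 : IsStationary (⋃ j, {α | α ∈ S ∧ β ≤ c α j}) := by
      refine h1.mono ?_
      rintro α ⟨hαS, hα⟩
      obtain ⟨i, hi⟩ := (hc α hαS).2 β hα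
      exact mem_iUnion.2 ⟨i, hαS, hi⟩
    rw [isStationary_iUnion_iff hK.ne' (by simpa using hχ)] at h2
    obtain ⟨j, hj⟩ := h2
    exact hb j (hj.mono fun α hα => ⟨hα.1, (hβ _ ⟨j, rfl⟩).le.trans hα.2⟩)
  let Γ : Set K := {γ | IsStationary {α | α ∈ S ∧ c α j = γ}}
  -- By Fodor, the j-th coordinate takes arbitrarily large values on stationary sets, so there are
  -- at least `cof K` many such values.
  have hΓ : IsCofinal Γ := by
    intro β
    obtain ⟨γ, hγ⟩ := (hj β).exists_fiber_of_regressive hK hI (f := fun α => c α j)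
      fun α hα => (hc α hα.1).1 j
    obtain ⟨α, ⟨-, hα⟩, rfl⟩ := hγ.nonempty
    exact ⟨_, hγ.mono fun x hx => ⟨hx.1.1, hx.2⟩, hα⟩
  obtain ⟨⟨emb, hemb⟩⟩ := (Cardinal.le_def _ _).1 (hι.trans (cof_le hΓ))
  let p : Γ → ι := Function.invFun emb
  have hp : Function.Surjective p := Function.invFun_surjective hemb
  refine ⟨fun α => if h : c α j ∈ Γ then p ⟨_, h⟩ else Classical.arbitrary ι, fun i => ?_⟩
  obtain ⟨γ, rfl⟩ := hp i
  refine IsStationary.mono γ.2 ?_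
  rintro α ⟨hα, hαγ⟩
  refine ⟨hα, ?_⟩
  have h : c α j ∈ Γ := by rw [hαγ]; exact γ.2
  simp only [dif_pos h]
  congr

end Stationary

/-! ### Heights in a tree -/

section Tree

variable {T : Type u} [PartialOrder T]

/-- The minimal elements of a set of nodes. -/
def minimalNodes (N : Set T) : Set T := {m | m ∈ N ∧ ∀ y < m, y ∉ N}

theorem isAntichain_minimalNodes (N : Set T) : IsAntichain (· ≤ ·) (minimalNodes N) := by
  intro x hx y hy hne h
  exact hy.2 x (lt_of_le_of_ne h hne) hx.1

variable [IsSetTree T]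

theorem le_or_le_of_le_of_le {x y z : T} (hx : x ≤ z) (hy : y ≤ z) : x ≤ y ∨ y ≤ x := by
  rcases hx.eq_or_lt with rfl | hx
  · exact Or.inr hy
  rcases hy.eq_or_lt with rfl | hy
  · exact Or.inl hx.le
  rcases trichotomous_of (fun a b : Iio z => a < b) ⟨x, hx⟩ ⟨y, hy⟩ with h | h | h
  · exact Or.inl (le_of_lt h)
  · exact Or.inl (congrArg Subtype.val h).le
  · exact Or.inr (le_of_lt h)

theorem treeHeight_eq_typein {x y : T} (h : y < x) :
    treeHeight y = Ordinal.typein (fun a b : Iio x => a < b) ⟨y, h⟩ := by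
  refine Ordinal.type_eq.2 ⟨?_⟩
  exact
    { toFun := fun a => ⟨⟨a.1, lt_trans a.2 h⟩, a.2⟩
      invFun := fun a => ⟨a.1.1, a.2⟩
      left_inv := fun _ => rfl
      right_inv := fun _ => rfl
      map_rel_iff' := Iff.rfl }

theorem treeHeight_strictMono : StrictMono (treeHeight : T → Ordinal.{u}) := fun y x h => by
  rw [treeHeight_eq_typein h]
  exact Ordinal.typein_lt_type _ _

theorem exists_le_treeHeight_eq {x : T} {ξ : Ordinal.{u}} (h : ξ ≤ treeHeight x) :
    ∃ y ≤ x, treeHeight y = ξ := by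
  rcases h.eq_or_lt with rfl | h
  · exact ⟨x, le_rfl, rfl⟩
  · obtain ⟨y, hy⟩ := Ordinal.typein_surj (fun a b : Iio x => a < b) h
    exact ⟨y, le_of_lt y.2, (treeHeight_eq_typein y.2).trans hy⟩

theorem le_of_treeHeight_le {x y : T} (h : x ≤ y ∨ y ≤ x) (hxy : treeHeight x ≤ treeHeight y) :
    x ≤ y := by
  rcases h with h | h
  · exact h
  · rcases h.eq_or_lt with rfl | h
    · exact le_rfl
    · exact absurd (treeHeight_strictMono h) hxy.not_gt

theorem eq_of_treeHeight_eq {x y : T} (h : x ≤ y ∨ y ≤ x) (hxy : treeHeight x = treeHeight y) :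
    x = y :=
  (le_of_treeHeight_le h hxy.le).antisymm (le_of_treeHeight_le h.symm hxy.ge)

theorem isAntichain_treeHeight_eq (ξ : Ordinal.{u}) :
    IsAntichain (· ≤ ·) {x : T | treeHeight x = ξ} := by
  intro x hx y hy hne h
  exact hne (eq_of_treeHeight_eq (Or.inl h) (hx.trans hy.symm))

theorem exists_minimalNodes_le {N : Set T} {x : T} (hx : x ∈ N) : ∃ m ∈ minimalNodes N, m ≤ x := by
  have wf : WellFounded (fun a b : T => treeHeight a < treeHeight b) :=
    InvImage.wf treeHeight wellFounded_lt
  have hne : (N ∩ Iic x).Nonempty := ⟨x, hx, le_rfl⟩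
  have hm : wf.min _ hne ∈ N ∩ Iic x := wf.min_mem _ hne
  refine ⟨wf.min _ hne, ⟨hm.1, fun y hy hyN => ?_⟩, hm.2⟩
  exact wf.not_lt_min (N ∩ Iic x) ⟨hyN, hy.le.trans hm.2⟩ (treeHeight_strictMono hy)

end Tree

/-! ### Souslin trees -/

section Souslin

variable {κ : Cardinal.{u}} {T : Type u}

theorem mk_biUnion_lt_of_isRegular (hκ : κ.IsRegular) {s : Set T} (hs : #s < κ) {f : T → Set T}
    (hf : ∀ x ∈ s, #(f x) < κ) : #(⋃ x ∈ s, f x : Set T) < κ :=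
  (card_biUnion_lt_iff_forall_of_isRegular (t := fun x _ => f x) hκ hs).2 hf

variable [PartialOrder T] [IsSetTree T]

namespace IsSouslinTree

theorem mk_lt_of_ne (hT : IsSouslinTree κ T) {s : Set T} (h : #s ≠ κ) : #s < κ :=
  lt_of_le_of_ne ((mk_set_le s).trans_eq hT.card_eq) h

theorem treeHeight_lt (hT : IsSouslinTree κ T) (x : T) : treeHeight x < κ.ord := by
  rw [lt_ord]
  refine hT.mk_lt_of_ne (s := Iio x) (hT.chain_card_ne _ fun y hy z hz _ => ?_)
  exact le_or_le_of_le_of_le (le_of_lt hy) (le_of_lt hz)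

theorem mk_level_lt (hT : IsSouslinTree κ T) (ξ : Ordinal.{u}) :
    #{x : T | treeHeight x = ξ} < κ :=
  hT.mk_lt_of_ne (hT.antichain_card_ne _ (isAntichain_treeHeight_eq ξ))

theorem mk_treeHeight_lt_lt (hT : IsSouslinTree κ T) (hκ : κ.IsRegular) {ξ : Ordinal.{u}}
    (hξ : ξ < κ.ord) : #{x : T | treeHeight x < ξ} < κ := by
  have h : {x : T | treeHeight x < ξ} =
      ⋃ i : ξ.ToType, {x : T | treeHeight x = Ordinal.typein (α := ξ.ToType) (· < ·) i} := by
    ext x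
    simp only [mem_ofPred_eq, mem_iUnion]
    constructor
    · intro hx
      obtain ⟨i, hi⟩ := Ordinal.typein_surj (α := ξ.ToType) (· < ·)
        (by simpa using hx : treeHeight x < Ordinal.type (α := ξ.ToType) (· < ·))
      exact ⟨i, hi.symm⟩
    · rintro ⟨i, hi⟩
      rw [hi]
      exact Ordinal.typein_lt_self i
  rw [h, card_iUnion_lt_iff_forall_of_isRegular hκ (by rw [mk_toType]; exact lt_ord.1 hξ)]
  exact fun i => hT.mk_level_lt _

theorem exists_treeHeight_bound (hT : IsSouslinTree κ T) (hκ : κ.IsRegular) {s : Set T}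
    (hs : #s < κ) : ∃ ξ < κ.ord, ∀ x ∈ s, treeHeight x < ξ := by
  refine ⟨⨆ x : s, (treeHeight x.1 + 1),
    Ordinal.iSup_add_one_lt_of_lt_cof (by rwa [hκ.cof_ord]) fun x => hT.treeHeight_lt _,
    fun x hx => ?_⟩
  exact (lt_add_one _).trans_le
    (le_ciSup (f := fun x : s => treeHeight x.1 + 1) Ordinal.bddAbove_of_small ⟨x, hx⟩)

theorem exists_treeHeight_ge (hT : IsSouslinTree κ T) (hκ : κ.IsRegular) {s : Set T}
    (hs : κ ≤ #s) {ξ : Ordinal.{u}} (hξ : ξ < κ.ord) : ∃ x ∈ s, ξ ≤ treeHeight x := by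
  by_contra! h
  exact (hs.trans (mk_le_mk_of_subset h)).not_gt (hT.mk_treeHeight_lt_lt hκ hξ)

/-- The nodes above which a small part of `B` lies cover a small part of `B`. -/
theorem mk_inter_small_cones_lt (hT : IsSouslinTree κ T) (hκ : κ.IsRegular) (B : Set T) :
    #(B ∩ {x | #(B ∩ Ici x : Set T) < κ} : Set T) < κ := by
  let N : Set T := {x | #(B ∩ Ici x : Set T) < κ}
  -- Minimal nodes form an antichain, so `B ∩ N` is covered by fewer than κ small cones.
  have hM : #(minimalNodes N) < κ :=
    hT.mk_lt_of_ne (hT.antichain_card_ne _ (isAntichain_minimalNodes N))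
  refine (mk_le_mk_of_subset ?_).trans_lt
    (mk_biUnion_lt_of_isRegular hκ hM (f := fun m => B ∩ Ici m) fun m hm => hm.1)
  rintro x ⟨hxB, hxN⟩
  obtain ⟨m, hm, hmx⟩ := exists_minimalNodes_le (N := N) hxN
  exact mem_biUnion hm ⟨hxB, hmx⟩

/-- From some height on, every node has `κ` many nodes above it. -/
theorem exists_forall_le_mk_Ici (hT : IsSouslinTree κ T) (hκ : κ.IsRegular) :
    ∃ ξ < κ.ord, ∀ x : T, ξ ≤ treeHeight x → κ ≤ #(Ici x) := by
  obtain ⟨ξ, hξ, h⟩ := hT.exists_treeHeight_bound hκ (hT.mk_inter_small_cones_lt hκ univ)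
  refine ⟨ξ, hξ, fun x hx => ?_⟩
  by_contra! hlt
  exact (h x ⟨mem_univ x, by simpa using hlt⟩).not_ge hx

/-- Every set of `κ` many nodes is everywhere large above some node. -/
theorem exists_forall_ge_le_mk_inter_Ici (hT : IsSouslinTree κ T) (hκ : κ.IsRegular) {B : Set T}
    (hB : #B = κ) : ∃ w, ∀ x ≥ w, κ ≤ #(B ∩ Ici x : Set T) := by
  by_contra! h
  let N : Set T := {x | #(B ∩ Ici x : Set T) < κ}
  have hM : #(minimalNodes N) < κ :=
    hT.mk_lt_of_ne (hT.antichain_card_ne _ (isAntichain_minimalNodes N))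
  obtain ⟨ξ, hξ, hbd⟩ := hT.exists_treeHeight_bound hκ hM
  -- A member of B above the heights of all minimal nodes of N has an extension in N; the minimal
  -- node below that extension is already below the member, which is thus in N.
  have hsub : B ⊆ (B ∩ N) ∪ {x | treeHeight x < ξ} := by
    intro x hx
    rcases lt_or_ge (treeHeight x) ξ with hlt | hge
    · exact Or.inr hlt
    refine Or.inl ⟨hx, ?_⟩
    obtain ⟨y, hxy, hy⟩ := h x
    obtain ⟨m, hm, hmy⟩ := exists_minimalNodes_le (N := N) hy
    have hmx : m ≤ x := le_of_treeHeight_le (le_or_le_of_le_of_le hmy hxy)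
      ((hbd m hm).le.trans hge)
    exact (mk_le_mk_of_subset (inter_subset_inter_right B (Ici_subset_Ici.2 hmx))).trans_lt hm.1
  refine (hB.symm.le.trans ((mk_le_mk_of_subset hsub).trans (mk_union_le _ _))).not_gt ?_
  exact add_lt_of_lt hκ.aleph0_le (hT.mk_inter_small_cones_lt hκ B) (hT.mk_treeHeight_lt_lt hκ hξ)

/-- The minimal elements of P are an antichain, hence fewer than κ many, hence of bounded height. -/
theorem exists_minimalNodes_bound (hT : IsSouslinTree κ T) (hκ : κ.IsRegular) (P : Set T) :
    ∃ ξ < κ.ord, ∀ b ∈ P, ∃ a ∈ P, treeHeight a < ξ ∧ a ≤ b := by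
  obtain ⟨ξ, hξ, hbd⟩ := hT.exists_treeHeight_bound hκ
    (hT.mk_lt_of_ne (hT.antichain_card_ne _ (isAntichain_minimalNodes P)))
  refine ⟨ξ, hξ, fun b hb => ?_⟩
  obtain ⟨m, hm, hmb⟩ := exists_minimalNodes_le hb
  exact ⟨m, hm.1, hbd m hm, hmb⟩

end IsSouslinTree

end Souslin

/-! ### Closed levels, large antichains and the enumeration of nodes -/

section Levels

variable {κ : Cardinal.{u}} {T : Type u} [PartialOrder T] [IsSetTree T] {ι : Type u}

/-- `η` is closed, on heights, under the functions `g · i`, restricted to nodes of height at least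
`ξ₀`. -/
def IsClosedLevel (ξ₀ : Ordinal.{u}) (g : T → ι → T) (η : Ordinal.{u}) : Prop :=
  ξ₀ ≤ η ∧ ∀ x, ξ₀ ≤ treeHeight x → treeHeight x < η → ∀ i, treeHeight (g x i) < η

theorem IsClosedLevel.of_forall_lt {ξ₀ η : Ordinal.{u}} {g : T → ι → T} (h₀ : ξ₀ ≤ η)
    (h : ∀ ζ < η, ∃ d ≤ η, ζ < d ∧ IsClosedLevel ξ₀ g d) : IsClosedLevel ξ₀ g η := by
  refine ⟨h₀, fun x hx hxη i => ?_⟩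
  obtain ⟨d, hd, hxd, hcl⟩ := h _ hxη
  exact (hcl.2 x hx hxd i).trans_le hd

namespace IsSouslinTree

/-- Each initial part of the tree has fewer than κ nodes, so its images under g have bounded height;
ω iterations reach a closure point below κ. -/
theorem exists_isClosedLevel (hT : IsSouslinTree κ T) (hκ : κ.IsRegular) (hκ' : ℵ₀ < κ)
    (hι : #ι < κ) {ξ₀ : Ordinal.{u}} (hξ₀ : ξ₀ < κ.ord) (g : T → ι → T) {ξ : Ordinal.{u}}
    (hξ : ξ < κ.ord) : ∃ η < κ.ord, ξ < η ∧ IsClosedLevel ξ₀ g η := by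
  have hlim : IsSuccLimit κ.ord := isSuccLimit_ord hκ.aleph0_le
  have step : ∀ ζ : Iio κ.ord, ∃ ζ' : Iio κ.ord, ζ < ζ' ∧
      ∀ x, treeHeight x < ζ.1 → ∀ i, treeHeight (g x i) < ζ'.1 := by
    rintro ⟨ζ, hζ⟩
    have hcard : #(⋃ x ∈ {x : T | treeHeight x < ζ}, range (g x) : Set T) < κ :=
      mk_biUnion_lt_of_isRegular hκ (hT.mk_treeHeight_lt_lt hκ hζ)
        fun x _ => mk_range_le.trans_lt hι
    obtain ⟨ξ', hξ', h⟩ := hT.exists_treeHeight_bound hκ hcard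
    refine ⟨⟨max (succ ζ) ξ', max_lt (hlim.succ_lt hζ) hξ'⟩,
      Subtype.mk_lt_mk.2 ((lt_succ ζ).trans_le (le_max_left _ _)), fun x hx i => ?_⟩
    exact (h _ (mem_biUnion (x := x) hx ⟨i, rfl⟩)).trans_le (le_max_right _ _)
  choose f hf hfg using step
  -- The exponent n + 1 puts `max ξ ξ₀` strictly below the first term.
  let s : ℕ → Iio κ.ord := fun n => f^[n + 1] ⟨max ξ ξ₀, max_lt hξ hξ₀⟩
  have hs : ∀ n, s (n + 1) = f (s n) := fun n => Function.iterate_succ_apply' f (n + 1) _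
  have h0 : max ξ ξ₀ < (s 0).1 := hf ⟨max ξ ξ₀, max_lt hξ hξ₀⟩
  have hle : ∀ n, (s n).1 ≤ ⨆ n, (s n).1 := fun n =>
    le_ciSup (f := fun n => (s n).1) Ordinal.bddAbove_of_small n
  refine ⟨⨆ n, (s n).1, ?_, ?_, ?_, ?_⟩
  · refine Ordinal.lift_iSup_lt_of_lt_cof ?_ fun n => (s n).2
    simpa [hκ.cof_ord] using hκ'
  · exact ((le_max_left _ _).trans_lt h0).trans_le (hle 0)
  · exact ((le_max_right _ _).trans_lt h0).le.trans (hle 0)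
  · intro x _ hx i
    obtain ⟨n, hn⟩ := (Ordinal.lt_iSup_iff).1 hx
    have := hfg (s n) x hn i
    rw [← hs] at this
    exact this.trans_le (hle _)

theorem exists_incomparable_above (hT : IsSouslinTree κ T) {x : T} (hx : κ ≤ #(Ici x)) :
    ∃ g : ULift.{u} Bool → T, (∀ i, x < g i) ∧ ∀ i j, i ≠ j → ¬ g i ≤ g j := by
  have hnc : ¬ IsChain (· ≤ ·) (Ici x) := fun h =>
    hT.chain_card_ne _ h (((mk_set_le _).trans_eq hT.card_eq).antisymm hx)
  simp only [IsChain, Set.Pairwise, not_forall, not_or] at hnc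
  obtain ⟨u, hu, v, hv, -, huv, hvu⟩ := hnc
  refine ⟨fun i => bif i.down then u else v, ?_, ?_⟩
  · rintro ⟨_ | _⟩
    · exact lt_of_le_of_ne hv fun h : x = v => hvu (h ▸ hu)
    · exact lt_of_le_of_ne hu fun h : x = u => huv (h ▸ hv)
  · rintro ⟨_ | _⟩ ⟨_ | _⟩ h
    · exact absurd rfl h
    · exact hvu
    · exact huv
    · exact absurd rfl h

/-- In a tree of size `λ⁺`, every node that is high enough has an antichain of size `λ` above it. -/
theorem exists_antichain_above {lam : Cardinal.{u}} (hlam : ℵ₀ ≤ lam)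
    (hT : IsSouslinTree (succ lam) T) {ξ₀ : Ordinal.{u}} (hξ₀ : ξ₀ < (succ lam).ord)
    (hbig : ∀ x : T, ξ₀ ≤ treeHeight x → succ lam ≤ #(Ici x)) {x : T} (hx : ξ₀ ≤ treeHeight x) :
    ∃ g : lam.ord.ToType → T, (∀ i, x < g i) ∧ ∀ i j, i ≠ j → ¬ g i ≤ g j := by
  have hκ := isRegular_succ hlam
  have hκ' : ℵ₀ < succ lam := hlam.trans_lt (lt_succ lam)
  have hsplit : ∀ y : T, ∃ g : ULift.{u} Bool → T, ξ₀ ≤ treeHeight y →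
      (∀ i, y < g i) ∧ ∀ i j, i ≠ j → ¬ g i ≤ g j := by
    intro y
    by_cases hy : ξ₀ ≤ treeHeight y
    · obtain ⟨g, hg⟩ := hT.exists_incomparable_above (hbig y hy)
      exact ⟨g, fun _ => hg⟩
    · exact ⟨fun _ => y, fun h => absurd h hy⟩
  choose G hG using hsplit
  have hι : #(ULift.{u} Bool) < succ lam := by
    refine lt_of_lt_of_le ?_ hκ'.le
    simp
  let κo := (succ lam).ord
  -- λ many levels above x closed under binary splitting are chosen, and a node z above x beyond
  -- them all. At each chosen level, one of the two splitting successors of the predecessor of z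
  -- leaves z, and it does so before the next chosen level. These successors form the antichain.
  let Q : Set κo.ToType := {k | treeHeight x < Ordinal.typein (α := κo.ToType) (· < ·) k ∧
    IsClosedLevel ξ₀ G (Ordinal.typein (α := κo.ToType) (· < ·) k)}
  have hQ : IsCofinal Q := by
    intro k
    obtain ⟨η, hη, hkη, hcl⟩ := hT.exists_isClosedLevel hκ hκ' hι hξ₀ G
      (max_lt (Ordinal.typein_lt_self k) (hT.treeHeight_lt x))
    obtain ⟨k', hk'⟩ := Ordinal.typein_surj (α := κo.ToType) (· < ·) (by simpa using hη)
    refine ⟨k', ⟨by rw [hk']; exact (le_max_right _ _).trans_lt hkη, by rwa [hk']⟩, ?_⟩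
    rw [← Ordinal.typein_le_typein' κo, hk']
    exact (le_max_left _ _).trans hkη.le
  have hQcard : #lam.ord.ToType ≤ #Q := by
    have h1 := cof_le hQ
    rw [Ordinal.cof_toType, hκ.cof_ord] at h1
    rw [mk_ord_toType]
    exact (le_succ lam).trans h1
  obtain ⟨⟨q, hq⟩⟩ := (Cardinal.le_def _ _).1 hQcard
  let d : lam.ord.ToType → Ordinal.{u} := fun i => Ordinal.typein (α := κo.ToType) (· < ·) (q i).1
  have hd : Function.Injective d := fun i j h =>
    hq (Subtype.ext (Ordinal.typein_injective (α := κo.ToType) (· < ·) h))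
  have hdx : ∀ i, treeHeight x < d i := fun i => (q i).2.1
  have hdcl : ∀ i, IsClosedLevel ξ₀ G (d i) := fun i => (q i).2.2
  have hsup : ⨆ i, d i + 1 < κo := Ordinal.iSup_add_one_lt_of_lt_cof
    (by rw [hκ.cof_ord, mk_ord_toType]; exact lt_succ lam) fun i => Ordinal.typein_lt_self _
  obtain ⟨η, hη, hsupη, hηcl⟩ := hT.exists_isClosedLevel hκ hκ' hι hξ₀ G hsup
  obtain ⟨z, hxz, hz⟩ := hT.exists_treeHeight_ge hκ (hbig x hx) hη
  have hdη : ∀ i, d i < η := fun i => ((lt_add_one _).trans_le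
    (le_ciSup (f := fun i => d i + 1) Ordinal.bddAbove_of_small i)).trans hsupη
  have hex : ∀ i, ∃ w u : T, treeHeight w = d i ∧ x ≤ w ∧ w ≤ z ∧ w < u ∧ ¬ u ≤ z ∧
      ∀ j, d i < d j → treeHeight u < d j := by
    intro i
    obtain ⟨w, hwz, hw⟩ := exists_le_treeHeight_eq ((hdη i).le.trans hz)
    have hwξ : ξ₀ ≤ treeHeight w := hw ▸ (hdcl i).1
    have hxw : x ≤ w := le_of_treeHeight_le (le_or_le_of_le_of_le hxz hwz) (hw ▸ (hdx i).le)
    obtain ⟨b, hb⟩ : ∃ b, ¬ G w b ≤ z := by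
      by_contra! hall
      rcases le_or_le_of_le_of_le (hall ⟨true⟩) (hall ⟨false⟩) with h | h
      · exact (hG w hwξ).2 _ _ (by simp) h
      · exact (hG w hwξ).2 _ _ (by simp) h
    exact ⟨w, G w b, hw, hxw, hwz, (hG w hwξ).1 b, hb,
      fun j hj => (hdcl j).2 w hwξ (hw ▸ hj) b⟩
  choose w g hw hxw hwz hwg hgz hgd using hex
  refine ⟨g, fun i => (hxw i).trans_lt (hwg i), fun i j hij hle => ?_⟩
  rcases lt_trichotomy (d i) (d j) with h | h | h
  · refine hgz i (le_trans ?_ (hwz j))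
    refine le_of_treeHeight_le (le_or_le_of_le_of_le hle (hwg j).le) ?_
    rw [hw]
    exact (hgd i j h).le
  · exact hij (hd h)
  · refine (treeHeight_strictMono.monotone hle).not_gt ((hgd j i h).trans ?_)
    rw [← hw i]
    exact treeHeight_strictMono (hwg i)

/-- The nodes with height in an unbounded set of levels are enumerated by `κ` in such a way that
the heights are nondecreasing. -/
theorem exists_enumeration (hT : IsSouslinTree κ T) (hκ : κ.IsRegular) {L : Set Ordinal.{u}}
    (hL : ∀ ξ < κ.ord, ∃ η < κ.ord, ξ < η ∧ η ∈ L) :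
    ∃ e : κ.ord.ToType → T, Function.Injective e ∧ (∀ x, x ∈ range e ↔ treeHeight x ∈ L) ∧
      Monotone fun β => treeHeight (e β) := by
  let T' : Set T := {x | treeHeight x ∈ L}
  have hT' : κ ≤ #T' := by
    by_contra! hlt
    obtain ⟨ξ, hξ, h⟩ := hT.exists_treeHeight_bound hκ hlt
    obtain ⟨η, hη, hξη, hηL⟩ := hL ξ hξ
    obtain ⟨x, -, hx⟩ := hT.exists_treeHeight_ge hκ (s := univ)
      (by rw [mk_univ]; exact hT.card_eq.ge) hη
    obtain ⟨y, -, hy⟩ := exists_le_treeHeight_eq hx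
    exact (h y (show treeHeight y ∈ L by rwa [hy])).not_gt (by rwa [hy])
  -- Order by height, ties broken by an arbitrary well-order. Every initial segment lies in a
  -- bounded part of the tree, so the order type is exactly κ.
  let key : T' → Ordinal.{u} ×ₗ Ordinal.{u} := fun x =>
    toLex (treeHeight x.1, Ordinal.typein (WellOrderingRel (α := T)) x.1)
  have hkey : Function.Injective key := by
    intro x y hxy
    have := congrArg (fun p => (ofLex p).2) hxy
    exact Subtype.ext (Ordinal.typein_injective (WellOrderingRel (α := T)) this)
  let r : T' → T' → Prop := fun x y => key x < key y
  have hr : IsWellOrder T' r := by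
    have emb : r ↪r ((· < ·) : Ordinal.{u} ×ₗ Ordinal.{u} → _ → Prop) := ⟨⟨key, hkey⟩, Iff.rfl⟩
    exact emb.isWellOrder
  have hrht : ∀ x y : T', r x y → treeHeight x.1 ≤ treeHeight y.1 := by
    intro x y h
    rcases Prod.Lex.toLex_lt_toLex.1 h with h | h
    · exact h.le
    · exact h.1.le
  have htype : Ordinal.type r = κ.ord := by
    refine le_antisymm (le_of_forall_lt fun a ha => ?_) (ord_le.2 (by simpa using hT'))
    obtain ⟨x, rfl⟩ := Ordinal.typein_surj r ha
    rw [lt_ord, Ordinal.card_typein]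
    have hlim : IsSuccLimit κ.ord := isSuccLimit_ord hκ.aleph0_le
    refine lt_of_le_of_lt ?_
      (hT.mk_treeHeight_lt_lt hκ (hlim.succ_lt (hT.treeHeight_lt x.1)))
    refine mk_le_of_injective (f := fun y : {y // r y x} =>
      (⟨y.1.1, lt_succ_of_le (hrht _ _ y.2)⟩ : {z : T | treeHeight z < succ (treeHeight x.1)})) ?_
    intro y y' h
    exact Subtype.ext (Subtype.ext (Subtype.mk.inj h))
  obtain ⟨φ⟩ := Ordinal.type_eq.1 ((Ordinal.type_toType κ.ord).trans htype.symm)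
  refine ⟨fun β => (φ β).1, fun β γ h => φ.injective (Subtype.ext h), fun x => ⟨?_, fun hx => ?_⟩,
    fun β γ h => ?_⟩
  · rintro ⟨β, rfl⟩
    exact (φ β).2
  · exact ⟨φ.symm ⟨x, hx⟩, by simp⟩
  · rcases h.eq_or_lt with rfl | h
    · exact le_rfl
    · exact hrht _ _ (φ.map_rel_iff.2 h)

end IsSouslinTree

end Levels

/-! ### Vanishing branches -/

section Branches

variable {χ : Cardinal.{u}} {T : Type u} [PartialOrder T]

/-- An increasing sequence of length less than `χ`, indexed by a well-order, is bounded. -/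
theorem IsCompleteTree.bddAbove_range (hT : IsCompleteTree χ T) {J : Type u} [LinearOrder J]
    [WellFoundedLT J] (hJ : #J < χ) {f : J → T} (hf : StrictMono f) : BddAbove (range f) := by
  have hlt : Ordinal.type (α := J) (· < ·) < χ.ord := by rwa [lt_ord, Ordinal.card_type]
  obtain ⟨φ⟩ := Ordinal.type_eq.1 (Ordinal.type_toType (Ordinal.type (α := J) (· < ·)))
  have h := hT _ hlt (f ∘ φ) fun i j hij => hf (φ.map_rel_iff.2 hij)
  rwa [φ.surjective.range_comp] at h

variable [IsSetTree T]

/-- A branch through the first `η` levels of the tree that has no upper bound. -/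
structure IsVanishingBranch (η : Ordinal.{u}) (c : Set T) : Prop where
  isChain : IsChain (· ≤ ·) c
  isLowerSet : IsLowerSet c
  treeHeight_lt : ∀ x ∈ c, treeHeight x < η
  exists_treeHeight_ge : ∀ ξ < η, ∃ x ∈ c, ξ ≤ treeHeight x
  not_bddAbove : ¬ BddAbove c

theorem IsVanishingBranch.le_or_le {η : Ordinal.{u}} {c : Set T} (hc : IsVanishingBranch η c)
    {x y : T} (hx : x ∈ c) (hy : y ∈ c) : x ≤ y ∨ y ≤ x :=
  hc.isChain.total hx hy

/-- Distinct vanishing branches separate below the smaller of their lengths. -/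
theorem IsVanishingBranch.exists_mem_forall_inter {η η' : Ordinal.{u}} {c c' : Set T}
    (hc : IsVanishingBranch η c) (hc' : IsVanishingBranch η' c') (hη : η ≤ η') (hne : c ≠ c') :
    ∃ x ∈ c, ∀ z ∈ c ∩ c', treeHeight z < treeHeight x := by
  obtain ⟨x, hxc, hxc'⟩ : ∃ x ∈ c, x ∉ c' := by
    -- If c ⊆ c', equal lengths force c = c', while a longer c' has a node at height at least η
    -- bounding c.
    by_contra! hsub
    rcases hη.eq_or_lt with rfl | hlt
    · refine hne (Subset.antisymm hsub fun x hx => ?_)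
      obtain ⟨y, hy, hxy⟩ := hc.exists_treeHeight_ge _ (hc'.treeHeight_lt x hx)
      exact hc.isLowerSet (le_of_treeHeight_le (hc'.le_or_le hx (hsub y hy)) hxy) hy
    · obtain ⟨y, hy, hηy⟩ := hc'.exists_treeHeight_ge η hlt
      exact hc.not_bddAbove ⟨y, fun x hx => le_of_treeHeight_le (hc'.le_or_le (hsub x hx) hy)
        ((hc.treeHeight_lt x hx).le.trans hηy)⟩
  refine ⟨x, hxc, fun z hz => lt_of_not_ge fun hle => hxc' ?_⟩
  exact hc'.isLowerSet (le_of_treeHeight_le (hc.le_or_le hxc hz.1) hle) hz.2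

/-- A recursive construction of a vanishing branch through `w`. At the stage `i` the current node
`s` is extended to some `u` with `P i s u`; the properties `P i` rule out all upper bounds. -/
theorem exists_isVanishingBranch (hT : IsCompleteTree χ T) (hχ : χ.IsRegular)
    {η : Ordinal.{u}} {f : χ.ord.ToType → Ordinal.{u}}
    (hcof : ∀ ξ < η, ∃ i, ξ ≤ f i) (hηχ : η.cof = χ)
    {P : χ.ord.ToType → T → T → Prop} {w : T} (hw : treeHeight w < η)
    (step : ∀ i s, w ≤ s → treeHeight s < η →
      ∃ u, s < u ∧ treeHeight u < η ∧ f i ≤ treeHeight u ∧ P i s u)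
    (kill : ∀ x, w ≤ x → treeHeight x = η → ∃ i, ∀ s u, w ≤ s → s < x →
      (∀ j < i, f j ≤ treeHeight s) → P i s u → ¬ u ≤ x) :
    ∃ c, IsVanishingBranch η c ∧ w ∈ c := by
  classical
  let J := χ.ord.ToType
  -- Limit stages: completeness gives some upper bound, which is cut down to the supremum of the
  -- heights so far. That supremum is below η because cf(η) = χ.
  have hlim : ∀ (i : J) (t : Iio i → T), StrictMono t → (∀ j, w ≤ t j) →
      (∀ j, treeHeight (t j) < η) → ∃ s, w ≤ s ∧ treeHeight s < η ∧ ∀ j, t j ≤ s := by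
    intro i t ht hwt htη
    by_cases hne : Nonempty (Iio i)
    · have hcard : #(Iio i) < χ := mk_Iio_ordToType_lt i
      obtain ⟨y, hy⟩ := hT.bddAbove_range hcard ht
      let σ := ⨆ j, treeHeight (t j)
      have hle : ∀ j, treeHeight (t j) ≤ σ := fun j => le_ciSup Ordinal.bddAbove_of_small j
      have hση : σ < η := Ordinal.iSup_lt_of_lt_cof (by rwa [hηχ]) htη
      have hσy : σ ≤ treeHeight y :=
        ciSup_le' fun j => treeHeight_strictMono.monotone (hy ⟨j, rfl⟩)
      obtain ⟨s, hsy, hs⟩ := exists_le_treeHeight_eq hσy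
      have hts : ∀ j, t j ≤ s := fun j =>
        le_of_treeHeight_le (le_or_le_of_le_of_le (hy ⟨j, rfl⟩) hsy) (hs ▸ hle j)
      exact ⟨s, (hwt hne.some).trans (hts _), hs ▸ hση, hts⟩
    · exact ⟨w, le_rfl, hw, fun j => absurd ⟨j⟩ hne⟩
  let R : J → Set T → T → T → Prop := fun i X s u => w ≤ s ∧ (∀ x ∈ X, x ≤ s) ∧
    s < u ∧ treeHeight u < η ∧ f i ≤ treeHeight u ∧ P i s u
  -- The default w is never used: `key` shows by induction that an extension always exists.
  let Φ : J → Set T → T := fun i X => if h : ∃ u s, R i X s u then h.choose else w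
  have hΦ : ∀ i X, (∃ u s, R i X s u) → ∃ s, R i X s (Φ i X) := by
    intro i X h
    have : Φ i X = h.choose := dif_pos h
    rw [this]
    exact h.choose_spec
  let t : J → T := WellFounded.fix (C := fun _ => T) (wellFounded_lt (α := J))
    fun i rec => Φ i (range fun j : Iio i => rec j.1 j.2)
  have ht : ∀ i, t i = Φ i (range fun j : Iio i => t j.1) := fun i => WellFounded.fix_eq _ _ i
  have key : ∀ i, ∃ s, R i (range fun j : Iio i => t j.1) s (t i) := by
    intro i
    induction i using WellFoundedLT.induction with
    | ind i ih =>
      have hmono : StrictMono fun j : Iio i => t j.1 := by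
        intro j k hjk
        obtain ⟨s, hs⟩ := ih k.1 k.2
        exact (hs.2.1 _ ⟨⟨j.1, hjk⟩, rfl⟩).trans_lt hs.2.2.1
      obtain ⟨s, hws, hsη, hs⟩ := hlim i _ hmono
        (fun j => by obtain ⟨s, hs⟩ := ih j.1 j.2; exact hs.1.trans hs.2.2.1.le)
        (fun j => by obtain ⟨s, hs⟩ := ih j.1 j.2; exact hs.2.2.2.1)
      obtain ⟨u, hsu, huη, hfu, hP⟩ := step i s hws hsη
      rw [ht i]
      exact hΦ _ _ ⟨u, s, hws, by rintro _ ⟨j, rfl⟩; exact hs j, hsu, huη, hfu, hP⟩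
  have hmono : StrictMono t := by
    intro j k hjk
    obtain ⟨s, hs⟩ := key k
    exact (hs.2.1 _ ⟨⟨j, hjk⟩, rfl⟩).trans_lt hs.2.2.1
  have hwt : ∀ i, w ≤ t i := fun i => by
    obtain ⟨s, hs⟩ := key i
    exact hs.1.trans hs.2.2.1.le
  have hne : Nonempty J := by
    rw [← mk_ne_zero_iff, mk_ord_toType]
    exact hχ.ne_zero
  have htη : ∀ i, treeHeight (t i) < η := fun i => by
    obtain ⟨s, hs⟩ := key i
    exact hs.2.2.2.1
  have hft : ∀ i, f i ≤ treeHeight (t i) := fun i => by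
    obtain ⟨s, hs⟩ := key i
    exact hs.2.2.2.2.1
  refine ⟨{x | ∃ i, x ≤ t i}, ⟨?_, ?_, ?_, ?_, ?_⟩, ⟨hne.some, hwt _⟩⟩
  · rintro x ⟨i, hi⟩ y ⟨j, hj⟩ -
    rcases le_total i j with h | h
    · exact le_or_le_of_le_of_le (hi.trans (hmono.monotone h)) hj
    · exact le_or_le_of_le_of_le hi (hj.trans (hmono.monotone h))
  · rintro x y hyx ⟨i, hi⟩
    exact ⟨i, hyx.trans hi⟩
  · rintro x ⟨i, hi⟩
    exact (treeHeight_strictMono.monotone hi).trans_lt (htη i)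
  · intro ξ hξ
    obtain ⟨i, hi⟩ := hcof ξ hξ
    exact ⟨t i, ⟨i, le_rfl⟩, hi.trans (hft i)⟩
  · rintro ⟨y, hy⟩
    have hty : ∀ i, t i ≤ y := fun i => hy ⟨i, le_rfl⟩
    have hηy : η ≤ treeHeight y := by
      refine le_of_forall_lt fun ξ hξ => ?_
      have hξ' : succ ξ < η := by
        have : IsSuccLimit η := by
          rw [← Ordinal.one_lt_cof_iff, hηχ]
          exact one_lt_aleph0.trans_le hχ.aleph0_le
        exact this.succ_lt hξ
      obtain ⟨i, hi⟩ := hcof _ hξ'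
      exact (lt_succ ξ).trans_le (hi.trans ((hft i).trans (treeHeight_strictMono.monotone (hty i))))
    -- An upper bound has a predecessor of height exactly η (or is one), which still bounds the
    -- branch; such nodes are excluded by `kill`.
    obtain ⟨x, hxy, hx⟩ := exists_le_treeHeight_eq hηy
    have htx : ∀ i, t i < x := by
      intro i
      refine lt_of_le_of_ne (le_of_treeHeight_le (le_or_le_of_le_of_le (hty i) hxy) ?_) ?_
      · rw [hx]
        exact (htη i).le
      · intro h
        exact (htη i).ne (h ▸ hx)
    obtain ⟨i, hi⟩ := kill x ((hwt hne.some).trans (htx _).le) hx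
    obtain ⟨s, hs⟩ := key i
    refine hi s (t i) hs.1 (hs.2.2.1.trans (htx i)) (fun j hj => ?_) hs.2.2.2.2.2 (htx i).le
    exact (hft j).trans (treeHeight_strictMono.monotone (hs.2.1 _ ⟨⟨j, hj⟩, rfl⟩))

end Branches

/-! ### Existence of vanishing branches in complete and in regressive trees -/

section Existence

variable {κ χ : Cardinal.{u}} {T : Type u} [PartialOrder T] [IsSetTree T] {ι : Type u}

theorem exists_cofinal_seq {η : Ordinal.{u}} (hη : η.cof = χ) :
    ∃ f : χ.ord.ToType → Ordinal.{u}, (∀ i, f i < η) ∧ ∀ ξ < η, ∃ i, ξ ≤ f i := by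
  obtain ⟨f, -, hf⟩ := exists_strictMono_isCofinal_range ((Ordinal.cof_toType η).trans hη)
  refine ⟨fun i => Ordinal.typein (α := η.ToType) (· < ·) (f i),
    fun i => Ordinal.typein_lt_self _, fun ξ hξ => ?_⟩
  obtain ⟨k, rfl⟩ := Ordinal.typein_surj (α := η.ToType) (· < ·) (by simpa using hξ)
  obtain ⟨_, ⟨i, rfl⟩, hi⟩ := hf k
  exact ⟨i, (Ordinal.typein_le_typein' η).2 hi⟩

theorem IsSouslinTree.exists_ge_treeHeight_eq (hT : IsSouslinTree κ T) (hκ : κ.IsRegular) {x : T}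
    (hx : κ ≤ #(Ici x)) {ξ : Ordinal.{u}} (hξ : ξ < κ.ord) (hxξ : treeHeight x ≤ ξ) :
    ∃ y, x ≤ y ∧ treeHeight y = ξ := by
  obtain ⟨z, hxz, hz⟩ := hT.exists_treeHeight_ge hκ hx hξ
  obtain ⟨y, hyz, hy⟩ := exists_le_treeHeight_eq hz
  exact ⟨y, le_of_treeHeight_le (le_or_le_of_le_of_le hxz hyz) (hy ▸ hxξ), hy⟩

/-- `g x` is an antichain above `x`, for all nodes `x` of height at least `ξ₀`. -/
def IsSplitting (ξ₀ : Ordinal.{u}) (g : T → ι → T) : Prop :=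
  ∀ x, ξ₀ ≤ treeHeight x → (∀ i, x < g x i) ∧ ∀ i j, i ≠ j → ¬ g x i ≤ g x j

theorem IsSplitting.eq_of_le {ξ₀ : Ordinal.{u}} {g : T → ι → T} (hg : IsSplitting ξ₀ g) {x y : T}
    (hx : ξ₀ ≤ treeHeight x) {i j : ι} (hi : g x i ≤ y) (hj : g x j ≤ y) : i = j := by
  by_contra hne
  rcases le_or_le_of_le_of_le hi hj with h | h
  · exact (hg x hx).2 _ _ hne h
  · exact (hg x hx).2 _ _ (Ne.symm hne) h

theorem exists_isSplitting {ξ₀ : Ordinal.{u}} (h : ∀ x : T, ξ₀ ≤ treeHeight x →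
    ∃ g : ι → T, (∀ i, x < g i) ∧ ∀ i j, i ≠ j → ¬ g i ≤ g j) :
    ∃ g : T → ι → T, IsSplitting ξ₀ g := by
  have h' : ∀ x : T, ∃ g : ι → T, ξ₀ ≤ treeHeight x →
      (∀ i, x < g i) ∧ ∀ i j, i ≠ j → ¬ g i ≤ g j := by
    intro x
    by_cases hx : ξ₀ ≤ treeHeight x
    · obtain ⟨g, hg⟩ := h x hx
      exact ⟨g, fun _ => hg⟩
    · exact ⟨fun _ => x, fun h => absurd h hx⟩
  choose g hg using h'
  exact ⟨g, hg⟩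

/-- Level η has at most λ nodes. Stage i handles the set `X i` of those with index at most `h i`,
where h is cofinal in λ of length cf(λ). -/
theorem IsSouslinTree.exists_isVanishingBranch_of_isCompleteTree {lam : Cardinal.{u}}
    (hlam : ℵ₀ ≤ lam) (hT : IsSouslinTree (succ lam) T) (hc : IsCompleteTree lam.ord.cof T)
    {ξ₀ : Ordinal.{u}} (hbig : ∀ x : T, ξ₀ ≤ treeHeight x → succ lam ≤ #(Ici x))
    {g : T → lam.ord.ToType → T} (hg : IsSplitting ξ₀ g) {η : Ordinal.{u}}
    (hη : η < (succ lam).ord) (hηcl : IsClosedLevel ξ₀ g η) (hηcof : η.cof = lam.ord.cof) {w : T}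
    (hwξ : ξ₀ ≤ treeHeight w) (hwη : treeHeight w < η) : ∃ c, IsVanishingBranch η c ∧ w ∈ c := by
  have hκ := isRegular_succ hlam
  have hχ : lam.ord.cof.IsRegular := isRegular_cof (isSuccLimit_ord hlam)
  obtain ⟨f, hfη, hfcof⟩ := exists_cofinal_seq hηcof
  obtain ⟨h, -, hh⟩ := exists_strictMono_isCofinal_range (Ordinal.cof_toType lam.ord)
  have hlev : #{x : T | treeHeight x = η} ≤ #lam.ord.ToType := by
    rw [mk_ord_toType]
    exact lt_succ_iff.1 (hT.mk_level_lt η)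
  obtain ⟨⟨ψ, hψ⟩⟩ := (Cardinal.le_def _ _).1 hlev
  let X : lam.ord.cof.ord.ToType → Set T := fun i =>
    Subtype.val '' {x : {x : T | treeHeight x = η} | ψ x ≤ h i}
  have hX : ∀ i, #(X i) < lam := by
    intro i
    have h1 : #(X i) ≤ #(Iic (h i)) := mk_image_le.trans
      (mk_le_of_injective (f := fun x => (⟨ψ x.1, x.2⟩ : Iic (h i)))
        fun x y hxy => Subtype.ext (hψ (Subtype.mk.inj hxy)))
    refine h1.trans_lt ?_
    rw [← Iio_insert]
    exact (mk_insert_le).trans_lt (add_lt_of_lt hlam (mk_Iio_ordToType_lt _)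
      (one_lt_aleph0.trans_le hlam))
  refine exists_isVanishingBranch hc hχ hfcof hηcof (P := fun i _ u => ∀ x ∈ X i, ¬ u ≤ x) hwη
    (fun i s hws hsη => ?_) (fun x _ hx => ?_)
  · have hsξ : ξ₀ ≤ treeHeight s := hwξ.trans (treeHeight_strictMono.monotone hws)
    obtain ⟨k, hk⟩ : ∃ k, ∀ x ∈ X i, ¬ g s k ≤ x := by
      -- Incomparable nodes have no common upper bound, so otherwise λ injects into `X i`.
      by_contra! hall
      choose y hyX hy using hall
      have hinj : Function.Injective fun k => (⟨y k, hyX k⟩ : X i) := by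
        intro k k' hkk
        have hkk' : y k = y k' := Subtype.mk.inj hkk
        exact hg.eq_of_le hsξ (hy k) (hkk' ▸ hy k')
      have := mk_le_of_injective hinj
      rw [mk_ord_toType] at this
      exact this.not_gt (hX i)
    have hsk := (hg s hsξ).1 k
    have hkη := hηcl.2 s hsξ hsη k
    have hm : max (treeHeight (g s k)) (f i) < η := max_lt hkη (hfη i)
    obtain ⟨u, hku, hu⟩ := hT.exists_ge_treeHeight_eq hκ
      (hbig _ (hsξ.trans (treeHeight_strictMono hsk).le)) (hm.trans hη) (le_max_left _ _)
    exact ⟨u, hsk.trans_le hku, hu ▸ hm, hu ▸ le_max_right _ _,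
      fun x hx hux => hk x hx (hku.trans hux)⟩
  · obtain ⟨_, ⟨i, rfl⟩, hi⟩ := hh (ψ ⟨x, hx⟩)
    exact ⟨i, fun s u _ _ _ hP => hP x ⟨⟨x, hx⟩, hi, rfl⟩⟩

theorem IsSouslinTree.exists_isVanishingBranch_of_isRegressiveTree (hκ : κ.IsRegular)
    (hT : IsSouslinTree κ T) (hc : IsCompleteTree ℵ₀ T) (hρ : IsRegressiveTree T)
    {ξ₀ : Ordinal.{u}} (hbig : ∀ x : T, ξ₀ ≤ treeHeight x → κ ≤ #(Ici x))
    {g : T → ULift.{u} Bool → T} (hg : IsSplitting ξ₀ g) {η : Ordinal.{u}}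
    (hη : η < κ.ord) (hηcl : IsClosedLevel ξ₀ g η) (hηcof : η.cof = ℵ₀) {w : T}
    (hwξ : ξ₀ ≤ treeHeight w) (hwη : treeHeight w < η) : ∃ c, IsVanishingBranch η c ∧ w ∈ c := by
  obtain ⟨ρ, hρlt, hρ⟩ := hρ
  obtain ⟨f, hfη, hfcof⟩ := exists_cofinal_seq hηcof
  have hηlim : IsSuccLimit η := by
    rw [← Ordinal.one_lt_cof_iff, hηcof]
    exact one_lt_aleph0
  refine exists_isVanishingBranch hc isRegular_aleph0 hfcof hηcof
    (P := fun i s u => ∀ x, treeHeight x = η → s < x → ρ x < s → ¬ u ≤ x) hwη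
    (fun i s hws hsη => ?_) (fun x _ hx => ?_)
  · have hsξ : ξ₀ ≤ treeHeight s := hwξ.trans (treeHeight_strictMono.monotone hws)
    -- Two nodes x, y of level η above s with ρ x, ρ y < s satisfy ρ x < y and ρ y < x, so they
    -- coincide; a single node cannot be above both splitting successors.
    obtain ⟨k, hk⟩ : ∃ k, ∀ x, treeHeight x = η → s < x → ρ x < s → ¬ g s k ≤ x := by
      by_contra! hall
      obtain ⟨x, hx, hsx, hρx, hgx⟩ := hall ⟨true⟩
      obtain ⟨y, hy, hsy, hρy, hgy⟩ := hall ⟨false⟩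
      have hxy : x = y := hρ x y (hx ▸ hηlim) (hx.trans hy.symm) (hρx.trans hsy) (hρy.trans hsx)
      have := hg.eq_of_le hsξ hgx (hxy ▸ hgy)
      simp at this
    have hsk := (hg s hsξ).1 k
    have hkη := hηcl.2 s hsξ hsη k
    have hm : max (treeHeight (g s k)) (f i) < η := max_lt hkη (hfη i)
    obtain ⟨u, hku, hu⟩ := hT.exists_ge_treeHeight_eq hκ
      (hbig _ (hsξ.trans (treeHeight_strictMono hsk).le)) (hm.trans hη) (le_max_left _ _)
    exact ⟨u, hsk.trans_le hku, hu ▸ hm, hu ▸ le_max_right _ _,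
      fun x hx hsx hρx hux => hk x hx hsx hρx (hku.trans hux)⟩
  · have hρx : ρ x < x := hρlt x (hx ▸ hηlim)
    have h1 : succ (treeHeight (ρ x)) < η := hηlim.succ_lt (hx ▸ treeHeight_strictMono hρx)
    obtain ⟨j, hj⟩ := hfcof _ h1
    have : NoMaxOrder (Cardinal.ord ℵ₀).ToType :=
      Cardinal.noMaxOrder le_rfl
    -- One stage later, the current node has already reached height `f j`, past ρ x.
    obtain ⟨i, hi⟩ := exists_gt j
    refine ⟨i, fun s u _ hsx hfs hP => hP x hx hsx ?_⟩
    have h2 : treeHeight (ρ x) < treeHeight s := (lt_succ _).trans_le (hj.trans (hfs j hi))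
    exact lt_of_le_of_ne (le_of_treeHeight_le (le_or_le_of_le_of_le hρx.le hsx.le) h2.le)
      fun h => h2.ne (congrArg _ h)

theorem isCompleteTree_aleph0 {T : Type u} [PartialOrder T] [Nonempty T] : IsCompleteTree ℵ₀ T := by
  intro o ho f hf
  have hfin : Finite o.ToType := by
    rw [← mk_lt_aleph0_iff, mk_toType]
    exact lt_ord.1 ho
  cases isEmpty_or_nonempty o.ToType
  · rw [range_eq_empty]
    exact bddAbove_empty
  · obtain ⟨i, hi⟩ := Finite.exists_max (id : o.ToType → o.ToType)
    exact ⟨f i, by rintro _ ⟨j, rfl⟩; exact hf.monotone (hi j)⟩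

/-! ### Counting small sets of nodes -/

/-- A function f codes a path: at stage k, take a bound of the nodes chosen so far and pass to its
`f k`-th splitting successor. Bounds of whole paths determine f. -/
theorem IsCompleteTree.mk_fun_le {J : Type u} [LinearOrder J] [WellFoundedLT J]
    (hc : IsCompleteTree χ T) (hJ : #J < χ) {ξ₀ : Ordinal.{u}} {g : T → ι → T}
    (hg : IsSplitting ξ₀ g) {r : T} (hr : ξ₀ ≤ treeHeight r) : #(J → ι) ≤ #T := by
  classical
  -- Inserting r keeps the path at heights at least ξ₀, where g splits.
  let Φ : Set T → T := fun X => if h : BddAbove (insert r X) then h.some else r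
  have hΦ : ∀ X, BddAbove (insert r X) → ∀ x ∈ insert r X, x ≤ Φ X := by
    intro X h x hx
    have : Φ X = h.some := dif_pos h
    rw [this]
    exact h.some_mem hx
  let s : (J → ι) → J → T := fun f => WellFounded.fix (C := fun _ => T) (wellFounded_lt (α := J))
    fun k rec => Φ (range fun j : Iio k => g (rec j.1 j.2) (f j.1))
  have hs : ∀ f k, s f k = Φ (range fun j : Iio k => g (s f j.1) (f j.1)) :=
    fun f k => WellFounded.fix_eq _ _ k
  have hξ : ∀ {y : T}, r ≤ y → ξ₀ ≤ treeHeight y := fun h =>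
    hr.trans (treeHeight_strictMono.monotone h)
  have hbdd : ∀ (f : J → ι) (I : Set J),
      (∀ k ∈ I, r ≤ s f k ∧ ∀ j < k, g (s f j) (f j) ≤ s f k) →
      BddAbove (insert r (range fun j : I => g (s f j.1) (f j.1))) := by
    intro f I hI
    have hmono : StrictMono fun j : I => g (s f j.1) (f j.1) := by
      intro j k hjk
      exact ((hI k.1 k.2).2 j.1 hjk).trans_lt ((hg _ (hξ (hI k.1 k.2).1)).1 _)
    obtain ⟨y, hy⟩ := hc.bddAbove_range ((mk_set_le I).trans_lt hJ) hmono
    rcases I.eq_empty_or_nonempty with rfl | ⟨k, hk⟩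
    · exact ⟨r, by rintro _ (rfl | ⟨j, rfl⟩); exacts [le_rfl, j.2.elim]⟩
    · refine ⟨y, ?_⟩
      rintro _ (rfl | h)
      · exact (hI k hk).1.trans (((hg _ (hξ (hI k hk).1)).1 _).le.trans (hy ⟨⟨k, hk⟩, rfl⟩))
      · exact hy h
  have key : ∀ f k, r ≤ s f k ∧ ∀ j < k, g (s f j) (f j) ≤ s f k := by
    intro f k
    induction k using WellFoundedLT.induction with
    | ind k ih =>
      have hb := hbdd f (Iio k) ih
      rw [hs f k]
      exact ⟨hΦ _ hb _ (mem_insert _ _), fun j hj =>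
        hΦ _ hb _ (mem_insert_of_mem _ ⟨⟨j, hj⟩, rfl⟩)⟩
  have hagree : ∀ f f' k, (∀ j < k, f j = f' j) → s f k = s f' k := by
    intro f f' k
    induction k using WellFoundedLT.induction with
    | ind k ih =>
      intro h
      rw [hs f k, hs f' k]
      congr 2
      funext j
      rw [ih j.1 j.2 fun i hi => h i (lt_trans hi j.2), h j.1 j.2]
  let F : (J → ι) → T := fun f => Φ (range fun j : (univ : Set J) => g (s f j.1) (f j.1))
  have hF : ∀ f k, g (s f k) (f k) ≤ F f := fun f k =>
    hΦ _ (hbdd f univ fun k _ => key f k) _ (mem_insert_of_mem _ ⟨⟨k, trivial⟩, rfl⟩)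
  refine mk_le_of_injective (f := F) fun f f' hff => ?_
  funext k
  induction k using WellFoundedLT.induction with
  | ind k ih =>
    -- Agreement before k gives the same node at stage k, and its successors chosen by f and f' lie
    -- below a common node.
    have h1 := hF f' k
    rw [← hagree f f' k ih, ← hff] at h1
    exact hg.eq_of_le (hξ (key f k).1) (hF f k) h1

/-- A set of fewer than cf(λ) nodes lies in a bounded part of the tree, of size at most λ, and
completeness yields λ^μ ≤ λ⁺ for μ < cf(λ). -/
theorem IsSouslinTree.mk_small_sets_le {lam : Cardinal.{u}} (hlam : ℵ₀ ≤ lam)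
    (hT : IsSouslinTree (succ lam) T) (hc : IsCompleteTree lam.ord.cof T) {ξ₀ : Ordinal.{u}}
    {g : T → lam.ord.ToType → T} (hg : IsSplitting ξ₀ g) {r : T} (hr : ξ₀ ≤ treeHeight r) :
    #{W : Set T // #W < lam.ord.cof} ≤ succ lam := by
  have hκ := isRegular_succ hlam
  have hκ' : ℵ₀ ≤ succ lam := hκ.aleph0_le
  have hχlam : lam.ord.cof ≤ lam := Ordinal.cof_ord_le lam
  let A := (succ lam).ord.ToType
  let C := lam.ord.cof.ord.ToType
  let μ : C → Cardinal.{u} := fun i => #(Iio i)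
  let f : A × C → Set (Set T) := fun p =>
    {W | W ⊆ {x | treeHeight x < Ordinal.typein (α := A) (· < ·) p.1} ∧ #W ≤ μ p.2}
  have hsub : {W : Set T | #W < lam.ord.cof} ⊆ ⋃ p, f p := by
    intro W hW
    have hW' : #W < lam.ord.cof := hW
    obtain ⟨ξ, hξ, hb⟩ := hT.exists_treeHeight_bound hκ
      (hW'.trans (hχlam.trans_lt (lt_succ lam)))
    obtain ⟨a, ha⟩ := Ordinal.typein_surj (α := A) (· < ·) (by simpa [A] using hξ)
    obtain ⟨i, hi⟩ := Ordinal.typein_surj (α := C) (· < ·) (o := (#W).ord)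
      (by simpa [C] using hW')
    refine mem_iUnion.2 ⟨(a, i), fun x hx => ?_, ?_⟩
    · change treeHeight x < Ordinal.typein (α := A) (· < ·) a
      rw [ha]
      exact hb x hx
    · have h2 : μ i = #W := by
        have := congrArg Ordinal.card hi
        rw [Ordinal.card_typein, card_ord] at this
        exact this
      exact h2.ge
  have hf : ∀ p, #(f p) ≤ succ lam := by
    intro p
    refine (mk_bounded_subset_le _ _).trans ?_
    have h1 : max #{x : T | treeHeight x < Ordinal.typein (α := A) (· < ·) p.1} ℵ₀ ≤ lam :=
      max_le (lt_succ_iff.1 (hT.mk_treeHeight_lt_lt hκ (Ordinal.typein_lt_self _))) hlam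
    refine (Cardinal.power_le_power_right h1).trans ?_
    have h2 := hc.mk_fun_le (J := Iio p.2) (mk_Iio_ordToType_lt _) hg hr
    rw [hT.card_eq, ← power_def, mk_ord_toType] at h2
    exact h2
  calc #{W : Set T | #W < lam.ord.cof} ≤ #(⋃ p, f p) := mk_le_mk_of_subset hsub
    _ ≤ #(A × C) * ⨆ p, #(f p) := mk_iUnion_le _
    _ ≤ succ lam * succ lam := by
      refine mul_le_mul' ?_ (ciSup_le' hf)
      rw [mk_prod, lift_id, lift_id, mk_ord_toType, mk_ord_toType]
      exact (mul_le_mul' le_rfl (hχlam.trans (le_succ lam))).trans_eq (mul_eq_self hκ')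
    _ = succ lam := mul_eq_self hκ'

theorem mk_finite_sets_le {T : Type u} (hT : #T = κ) (hκ : ℵ₀ ≤ κ) : #{W : Set T // #W < ℵ₀} ≤ κ := by
  have : Infinite T := by rw [infinite_iff, hT]; exact hκ
  rw [← hT, ← mk_finset_of_infinite T]
  refine mk_le_of_injective
    (f := fun W : {W : Set T // #W < ℵ₀} => (Set.Finite.toFinset (lt_aleph0_iff_set_finite.1 W.2)))
    fun W W' h => Subtype.ext ?_
  simpa using h

end Existence

/-! ### Disjoint ladders of minimal order type -/

section Ladders

variable {χ : Cardinal.{u}}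

theorem exists_lt_forall_lt_of_mk_lt_cof {K : Type u} [LinearOrder K] {α : K} {s : Set K}
    (hs : s ⊆ Iio α) (h : #s < cof (Iio α)) : ∃ δ < α, ∀ y ∈ s, y < δ := by
  have h1 : #((Subtype.val : Iio α → K) ⁻¹' s) < cof (Iio α) :=
    (mk_preimage_of_injective _ _ Subtype.val_injective).trans_lt h
  obtain ⟨x, hx⟩ := exists_forall_lt_of_mk_lt_cof h1
  exact ⟨x.1, x.2, fun y hy => hx ⟨y, hs hy⟩ hy⟩

theorem exists_lt_forall_lt_of_fun {K : Type u} [LinearOrder K] {α : K} {ι : Type u} {f : ι → K}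
    (hf : ∀ i, f i < α) (h : #ι < cof (Iio α)) : ∃ δ < α, ∀ i, f i < δ := by
  obtain ⟨δ, hδ, h'⟩ := exists_lt_forall_lt_of_mk_lt_cof (s := range f)
    (by rintro _ ⟨i, rfl⟩; exact hf i) (mk_range_le.trans_lt h)
  exact ⟨δ, hδ, fun i => h' _ ⟨i, rfl⟩⟩

theorem exists_between_of_aleph0_le_cof {K : Type u} [LinearOrder K] {α : K}
    (h : ℵ₀ ≤ cof (Iio α)) {β : K} (hβ : β < α) : ∃ γ, β < γ ∧ γ < α := by
  obtain ⟨δ, hδ, h'⟩ := exists_lt_forall_lt_of_mk_lt_cof (s := {β})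
    (singleton_subset_iff.2 hβ) (by rw [mk_singleton]; exact one_lt_aleph0.trans_le h)
  exact ⟨δ, h' β rfl, hδ⟩

theorem Iio_nonempty_of_aleph0_le_cof {K : Type u} [LinearOrder K] {α : K}
    (h : ℵ₀ ≤ cof (Iio α)) : (Iio α).Nonempty :=
  nonempty_coe_sort.1 (cof_ne_zero_iff.1 (aleph0_pos.trans_le h).ne')

/-- Every point of cofinality `χ` has `χ` many pairwise disjoint ladders of order type `χ` above a
given point. -/
theorem exists_disjoint_thin_ladders {K : Type u} [LinearOrder K] [WellFoundedLT K]
    (hχ : ℵ₀ ≤ χ) {α β : K} (hα : cof (Iio α) = χ) (hβ : β < α) :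
    ∃ A : χ.ord.ToType → Set K, (∀ j, IsCofinalSubset (A j) α) ∧
      (∀ i j, i ≠ j → Disjoint (A i) (A j)) ∧ (∀ j, A j ⊆ Ici β) ∧
      ∀ j, ∀ γ < α, #(A j ∩ Iio γ : Set K) < χ := by
  obtain ⟨f, hf, hfα, hfc⟩ := exists_strictMono_cofinal hα
  -- The ladder is divided along a partition of χ into χ many sets of size χ; each is unbounded
  -- since initial segments of χ are smaller.
  obtain ⟨p⟩ : Nonempty (χ.ord.ToType ≃ χ.ord.ToType × χ.ord.ToType) := by
    rw [← Cardinal.eq, mk_prod, lift_id, mk_ord_toType, mul_eq_self hχ]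
  refine ⟨fun j => f '' {k | (p k).1 = j ∧ β ≤ f k}, fun j => ⟨?_, fun γ hγ => ?_⟩, ?_, ?_, ?_⟩
  · rintro _ ⟨k, -, rfl⟩
    exact hfα k
  · obtain ⟨i, hi⟩ := hfc _ (max_lt hγ hβ)
    obtain ⟨k, hk, hik⟩ : ∃ k, (p k).1 = j ∧ i ≤ k := by
      by_contra! h
      have hinj : Function.Injective fun l => (⟨p.symm (j, l), h _ (by simp)⟩ : Iio i) := by
        intro l l' hll
        simpa using Subtype.mk.inj hll
      have := mk_le_of_injective hinj
      rw [mk_ord_toType] at this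
      exact this.not_gt (mk_Iio_ordToType_lt i)
    have hle := hi.trans (hf.monotone hik)
    exact ⟨f k, ⟨k, ⟨hk, (le_max_right _ _).trans hle⟩, rfl⟩, (le_max_left _ _).trans hle⟩
  · intro i j hij
    rw [disjoint_left]
    rintro _ ⟨k, ⟨hk, -⟩, rfl⟩ ⟨k', ⟨hk', -⟩, h⟩
    rw [hf.injective h, hk] at hk'
    exact hij hk'
  · rintro j _ ⟨k, ⟨-, hk⟩, rfl⟩
    exact hk
  · intro j γ hγ
    obtain ⟨i, hi⟩ := hfc γ hγ
    have hsub : f '' {k | (p k).1 = j ∧ β ≤ f k} ∩ Iio γ ⊆ f '' Iio i := by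
      rintro _ ⟨⟨k, -, rfl⟩, hk⟩
      exact ⟨k, hf.lt_iff_lt.1 (lt_of_lt_of_le hk hi), rfl⟩
    exact (mk_le_mk_of_subset hsub).trans_lt (mk_image_le.trans_lt (mk_Iio_ordToType_lt i))

end Ladders

/-! ### Families of distinct vanishing branches -/

section ManyBranches

variable {χ : Cardinal.{u}} {T : Type u} [PartialOrder T] [IsSetTree T] {ι : Type u}

/-- If vanishing branches exist through all nodes below `η`, then there are at least `χ` many
through each of them. -/
theorem exists_isVanishingBranch_notMem [Nontrivial ι] {ξ₀ η : Ordinal.{u}}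
    {g : T → ι → T} (hg : IsSplitting ξ₀ g) (hη : IsClosedLevel ξ₀ g η) (hηcof : η.cof = χ)
    (hvan : ∀ w : T, ξ₀ ≤ treeHeight w → treeHeight w < η → ∃ c, IsVanishingBranch η c ∧ w ∈ c)
    {w : T} (hwξ : ξ₀ ≤ treeHeight w) (hwη : treeHeight w < η) {𝒞 : Set (Set T)} (h𝒞 : #𝒞 < χ) :
    ∃ c, IsVanishingBranch η c ∧ w ∈ c ∧ c ∉ 𝒞 := by
  by_contra! hall
  obtain ⟨b, hb, hwb⟩ := hvan w hwξ hwη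
  -- Every other vanishing branch in 𝒞 leaves b at a height below η, and fewer than χ = cf(η) such
  -- heights are bounded. Splitting away from b beyond the bound gives a vanishing branch outside 𝒞.
  have hx : ∀ c : 𝒞, ∃ x ∈ b, IsVanishingBranch η c.1 → c.1 ≠ b →
      ∀ z ∈ b ∩ c.1, treeHeight z < treeHeight x := by
    intro c
    by_cases hc : IsVanishingBranch η c.1 ∧ c.1 ≠ b
    · obtain ⟨x, hx, h⟩ := hb.exists_mem_forall_inter hc.1 le_rfl hc.2.symm
      exact ⟨x, hx, fun _ _ => h⟩
    · exact ⟨w, hwb, fun h1 h2 => absurd ⟨h1, h2⟩ hc⟩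
  choose x hxb hx using hx
  have hsup : ⨆ c, treeHeight (x c) < η :=
    Ordinal.iSup_lt_of_lt_cof (by rwa [hηcof]) fun c => hb.treeHeight_lt _ (hxb c)
  obtain ⟨s, hsb, hs⟩ := hb.exists_treeHeight_ge _ (max_lt hsup hwη)
  have hws : w ≤ s := le_of_treeHeight_le (hb.le_or_le hwb hsb) ((le_max_right _ _).trans hs)
  have hsξ : ξ₀ ≤ treeHeight s := hwξ.trans (treeHeight_strictMono.monotone hws)
  obtain ⟨i, hi⟩ : ∃ i, g s i ∉ b := by
    by_contra! h
    obtain ⟨i, j, hij⟩ := exists_pair_ne ι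
    rcases hb.le_or_le (h i) (h j) with h' | h'
    · exact (hg s hsξ).2 _ _ hij h'
    · exact (hg s hsξ).2 _ _ hij.symm h'
  have hsi := (hg s hsξ).1 i
  obtain ⟨c, hc, hic⟩ := hvan (g s i) (hsξ.trans (treeHeight_strictMono hsi).le)
    (hη.2 s hsξ (hb.treeHeight_lt s hsb) i)
  have hsc : s ∈ c := hc.isLowerSet hsi.le hic
  have hc𝒞 : c ∈ 𝒞 := hall c hc (hc.isLowerSet hws hsc)
  have h1 := hx ⟨c, hc𝒞⟩ hc (fun h => hi (h ▸ hic)) s ⟨hsb, hsc⟩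
  have h2 : treeHeight (x ⟨c, hc𝒞⟩) ≤ ⨆ c, treeHeight (x c) :=
    le_ciSup (f := fun c => treeHeight (x c)) Ordinal.bddAbove_of_small _
  exact (h1.trans_le (h2.trans ((le_max_left _ _).trans hs))).false

theorem exists_family_isVanishingBranch (hχ : ℵ₀ ≤ χ) [Nontrivial ι] {ξ₀ η : Ordinal.{u}}
    {g : T → ι → T} (hg : IsSplitting ξ₀ g) (hη : IsClosedLevel ξ₀ g η) (hηcof : η.cof = χ)
    (hvan : ∀ w : T, ξ₀ ≤ treeHeight w → treeHeight w < η → ∃ c, IsVanishingBranch η c ∧ w ∈ c)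
    {W : Set T} (hW : ∀ w ∈ W, ξ₀ ≤ treeHeight w ∧ treeHeight w < η) (hWχ : #W < χ) :
    ∃ b : χ.ord.ToType → W → Set T, (∀ j w, IsVanishingBranch η (b j w) ∧ w.1 ∈ b j w) ∧
      ∀ i j, i ≠ j → ∀ w w', b i w ≠ b j w' := by
  have hex : ∀ (w : W) (𝒞 : Set (Set T)), ∃ c, #𝒞 < χ →
      (IsVanishingBranch η c ∧ w.1 ∈ c) ∧ c ∉ 𝒞 := by
    intro w 𝒞
    by_cases h : #𝒞 < χ
    · obtain ⟨c, h1, h2, h3⟩ := exists_isVanishingBranch_notMem hg hη hηcof hvan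
        (hW w.1 w.2).1 (hW w.1 w.2).2 h
      exact ⟨c, fun _ => ⟨⟨h1, h2⟩, h3⟩⟩
    · exact ⟨∅, fun h' => absurd h' h⟩
  choose Φ hΦ using hex
  let b : χ.ord.ToType → W → Set T := WellFounded.fix (C := fun _ => W → Set T)
    (wellFounded_lt (α := χ.ord.ToType))
    fun j rec w => Φ w (range fun p : Iio j × W => rec p.1.1 p.1.2 p.2)
  have hb : ∀ j w, b j w = Φ w (range fun p : Iio j × W => b p.1.1 p.2) := by
    intro j w
    have h : b j = fun w => Φ w (range fun p : Iio j × W => b p.1.1 p.2) :=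
      WellFounded.fix_eq _ _ j
    exact congrFun h w
  have hcard : ∀ j, #(range fun p : Iio j × W => b p.1.1 p.2) < χ := by
    intro j
    refine mk_range_le.trans_lt ?_
    rw [mk_prod, lift_id, lift_id]
    exact mul_lt_of_lt hχ (mk_Iio_ordToType_lt j) hWχ
  have hne : ∀ i j, i < j → ∀ w w', b i w ≠ b j w' := by
    intro i j hij w w' h
    have := (hΦ w' _ (hcard j)).2
    rw [← hb] at this
    exact this ⟨(⟨i, hij⟩, w), h⟩
  refine ⟨b, fun j w => ?_, fun i j hij w w' => ?_⟩
  · rw [hb]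
    exact (hΦ w _ (hcard j)).1
  · rcases hij.lt_or_gt with h | h
    · exact hne i j h w w'
    · exact (hne j i h w' w).symm

end ManyBranches

/-! ### Ladders as traces of vanishing branches -/

section Core

variable {κ χ : Cardinal.{u}} {T : Type u} [PartialOrder T] [IsSetTree T] {ι : Type u}

/-- The supremum of the heights of the nodes enumerated below `α`. -/
noncomputable def limitHeight (e : κ.ord.ToType → T) (α : κ.ord.ToType) : Ordinal.{u} :=
  ⨆ β : Iio α, treeHeight (e β)

/-- `α` is a limit of the enumeration `e` in the sense that the heights of the nodes enumerated
below `α` have no maximum. -/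
def IsLimitOfHeights (e : κ.ord.ToType → T) (α : κ.ord.ToType) : Prop :=
  ∀ β < α, ∃ γ < α, treeHeight (e β) < treeHeight (e γ)

variable {e : κ.ord.ToType → T} {α : κ.ord.ToType}

theorem IsLimitOfHeights.lt_limitHeight (h : IsLimitOfHeights e α) {β : κ.ord.ToType} (hβ : β < α) :
    treeHeight (e β) < limitHeight e α := by
  obtain ⟨γ, hγ, hlt⟩ := h β hβ
  exact hlt.trans_le
    (le_ciSup (f := fun β : Iio α => treeHeight (e β)) Ordinal.bddAbove_of_small ⟨γ, hγ⟩)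

theorem exists_lt_of_lt_limitHeight {ξ : Ordinal.{u}} (hξ : ξ < limitHeight e α) :
    ∃ β < α, ξ < treeHeight (e β) := by
  obtain ⟨β, hβ⟩ := Ordinal.lt_iSup_iff.1 hξ
  exact ⟨β.1, β.2, hβ⟩

theorem IsLimitOfHeights.cof_limitHeight (h : IsLimitOfHeights e α)
    (hmono : Monotone fun β => treeHeight (e β)) (hα : cof (Iio α) = χ) :
    (limitHeight e α).cof = χ := by
  apply le_antisymm
  · obtain ⟨f, -, hf, hfc⟩ := exists_strictMono_cofinal hα
    have heq : limitHeight e α = ⨆ i, treeHeight (e (f i)) + 1 := by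
      apply le_antisymm
      · refine ciSup_le' fun β => ?_
        obtain ⟨i, hi⟩ := hfc β.1 β.2
        refine (hmono hi).trans ((le_add_right le_rfl).trans
          (le_ciSup (f := fun i => treeHeight (e (f i)) + 1) Ordinal.bddAbove_of_small i))
      · exact ciSup_le' fun i => add_one_le_of_lt (h.lt_limitHeight (hf i))
    rw [heq]
    exact (Ordinal.cof_iSup_add_one_le _).trans_eq (mk_ord_toType χ)
  · by_contra! hlt
    obtain ⟨f, hf, hfc⟩ := exists_cofinal_seq (rfl : (limitHeight e α).cof = _)
    choose β hβα hβ using fun i => exists_lt_of_lt_limitHeight (hf i)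
    obtain ⟨δ, hδ, hδβ⟩ := exists_lt_forall_lt_of_fun hβα
      (by rwa [mk_ord_toType, hα])
    obtain ⟨i, hi⟩ := hfc _ (h.lt_limitHeight hδ)
    exact ((hβ i).trans_le (hmono (hδβ i).le)).not_ge hi

theorem limitHeight_lt (hκ : κ.IsRegular) (hT : IsSouslinTree κ T) :
    limitHeight e α < κ.ord :=
  Ordinal.iSup_lt_of_lt_cof (by rw [hκ.cof_ord]; exact mk_Iio_ordToType_lt α)
    fun _ => hT.treeHeight_lt _

theorem IsLimitOfHeights.isClosedLevel (h : IsLimitOfHeights e α) {ξ₀ : Ordinal.{u}}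
    {g : T → ι → T} (he : ∀ β, IsClosedLevel ξ₀ g (treeHeight (e β))) (hne : (Iio α).Nonempty) :
    IsClosedLevel ξ₀ g (limitHeight e α) := by
  obtain ⟨β, hβ⟩ := hne
  refine .of_forall_lt ((he β).1.trans (h.lt_limitHeight hβ).le) fun ζ hζ => ?_
  obtain ⟨γ, hγ, hζγ⟩ := exists_lt_of_lt_limitHeight hζ
  exact ⟨_, (h.lt_limitHeight hγ).le, hζγ, he γ⟩

theorem lt_of_mem_branch (hmono : Monotone fun β => treeHeight (e β)) {c : Set T}
    (hc : IsVanishingBranch (limitHeight e α) c) {β : κ.ord.ToType} (hβ : e β ∈ c) : β < α := by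
  obtain ⟨γ, hγ, hlt⟩ := exists_lt_of_lt_limitHeight (hc.treeHeight_lt _ hβ)
  exact (hmono.reflect_lt hlt).trans hγ

/-- The enumeration exhausts whole levels, so the branch's node on the level of a later `e γ` is
itself enumerated. -/
theorem IsLimitOfHeights.exists_gt_mem_branch (h : IsLimitOfHeights e α)
    (hmono : Monotone fun β => treeHeight (e β)) {L : Set Ordinal.{u}}
    (he : ∀ x, x ∈ range e ↔ treeHeight x ∈ L) {c : Set T}
    (hc : IsVanishingBranch (limitHeight e α) c) {β : κ.ord.ToType} (hβ : β < α) :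
    ∃ γ, β < γ ∧ e γ ∈ c := by
  obtain ⟨γ, hγ, hlt⟩ := h β hβ
  obtain ⟨y, hy, hγy⟩ := hc.exists_treeHeight_ge _ (h.lt_limitHeight hγ)
  obtain ⟨x, hxy, hx⟩ := exists_le_treeHeight_eq hγy
  obtain ⟨δ, rfl⟩ := (he x).2 (hx ▸ (he (e γ)).1 ⟨γ, rfl⟩)
  exact ⟨δ, hmono.reflect_lt (hx ▸ hlt), hc.isLowerSet hxy hy⟩

/-- `A` is covered by the traces of fewer than `χ` many vanishing branches of length
`limitHeight e α`. -/
def IsCoveredByBranches (χ : Cardinal.{u}) (e : κ.ord.ToType → T) (α : κ.ord.ToType)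
    (A : Set κ.ord.ToType) : Prop :=
  IsLimitOfHeights e α ∧ ∃ 𝒞 : Set (Set T), #𝒞 < χ ∧
    (∀ c ∈ 𝒞, IsVanishingBranch (limitHeight e α) c) ∧ ∀ β ∈ A, ∃ c ∈ 𝒞, e β ∈ c

/-- A limit of heights carries `χ` many pairwise disjoint ladders, each of which contains a tail of
a vanishing branch through every member of a given small set `W` of nodes. -/
theorem IsLimitOfHeights.exists_ladders (h : IsLimitOfHeights e α) (hχ : ℵ₀ ≤ χ) [Nontrivial ι]
    (hα : cof (Iio α) = χ) (hmono : Monotone fun β => treeHeight (e β))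
    {ξ₀ : Ordinal.{u}} {g : T → ι → T} (hg : IsSplitting ξ₀ g)
    (he : ∀ x, x ∈ range e ↔ treeHeight x ∈ {η | IsClosedLevel ξ₀ g η})
    (hvan : ∀ w : T, ξ₀ ≤ treeHeight w → treeHeight w < limitHeight e α →
      ∃ c, IsVanishingBranch (limitHeight e α) c ∧ w ∈ c)
    {W : Set T} (hW : ∀ w ∈ W, ξ₀ ≤ treeHeight w ∧ treeHeight w < limitHeight e α)
    (hWχ : #W < χ) (hWne : W.Nonempty) :
    ∃ A : χ.ord.ToType → Set κ.ord.ToType, (∀ j, IsCofinalSubset (A j) α) ∧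
      (∀ i j, i ≠ j → Disjoint (A i) (A j)) ∧ (∀ j, IsCoveredByBranches χ e α (A j)) ∧
      ∀ j, ∀ w ∈ W, ∃ c, IsVanishingBranch (limitHeight e α) c ∧ w ∈ c ∧
        ∃ δ < α, ∀ β, δ ≤ β → e β ∈ c → β ∈ A j := by
  have hne : (Iio α).Nonempty := Iio_nonempty_of_aleph0_le_cof (hα ▸ hχ)
  have hcl : IsClosedLevel ξ₀ g (limitHeight e α) :=
    h.isClosedLevel (fun β => (he (e β)).1 ⟨β, rfl⟩) hne
  obtain ⟨b, hb, hbne⟩ := exists_family_isVanishingBranch hχ hg hcl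
    (h.cof_limitHeight hmono hα) hvan hW hWχ
  -- Removing the traces of all earlier families makes the ladders disjoint. Only a bounded part of
  -- each trace is lost, since fewer than χ branches are removed and each separates below η.
  let A : χ.ord.ToType → Set κ.ord.ToType := fun j =>
    {β | (∃ w, e β ∈ b j w) ∧ ∀ i < j, ∀ w, e β ∉ b i w}
  have htail : ∀ j w, ∃ δ < α, ∀ β, δ ≤ β → e β ∈ b j w → β ∈ A j := by
    intro j w
    have hsep : ∀ p : Iio j × W, ∃ γ < α, ∀ z ∈ b j w ∩ b p.1.1 p.2,
        treeHeight z < treeHeight (e γ) := by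
      intro p
      obtain ⟨x, hx, hxz⟩ := (hb j w).1.exists_mem_forall_inter (hb p.1.1 p.2).1 le_rfl
        (hbne _ _ (ne_of_gt p.1.2) _ _)
      obtain ⟨γ, hγ, hxγ⟩ := exists_lt_of_lt_limitHeight ((hb j w).1.treeHeight_lt x hx)
      exact ⟨γ, hγ, fun z hz => (hxz z hz).trans hxγ⟩
    choose γ hγα hγ using hsep
    obtain ⟨δ, hδ, hδγ⟩ := exists_lt_forall_lt_of_fun hγα (by
      rw [mk_prod, lift_id, lift_id, hα]
      exact mul_lt_of_lt hχ (mk_Iio_ordToType_lt j) hWχ)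
    refine ⟨δ, hδ, fun β hδβ hβ => ⟨⟨w, hβ⟩, fun i hi w' hβ' => ?_⟩⟩
    exact (hγ (⟨i, hi⟩, w') _ ⟨hβ, hβ'⟩).not_ge (hmono ((hδγ _).le.trans hδβ))
  refine ⟨A, fun j => ⟨?_, fun γ hγ => ?_⟩, ?_, fun j => ⟨h, range (b j), ?_, ?_, ?_⟩,
    fun j w hw => ?_⟩
  · rintro β ⟨⟨w, hβ⟩, -⟩
    exact lt_of_mem_branch hmono (hb j w).1 hβ
  · obtain ⟨w, hw⟩ := hWne
    obtain ⟨δ, hδ, hA⟩ := htail j ⟨w, hw⟩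
    obtain ⟨β, hlt, hβ⟩ := h.exists_gt_mem_branch hmono he (hb j ⟨w, hw⟩).1 (max_lt hγ hδ)
    exact ⟨β, hA β ((le_max_right _ _).trans hlt.le) hβ, (le_max_left _ _).trans hlt.le⟩
  · intro i j hij
    rw [disjoint_left]
    rintro β ⟨⟨w, hw⟩, hi⟩ ⟨⟨w', hw'⟩, hj⟩
    rcases hij.lt_or_gt with hlt | hlt
    · exact hj i hlt w hw
    · exact hi j hlt w' hw'
  · exact mk_range_le.trans_lt hWχ
  · rintro _ ⟨w, rfl⟩
    exact (hb j w).1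
  · rintro β ⟨⟨w, hβ⟩, -⟩
    exact ⟨_, ⟨w, rfl⟩, hβ⟩
  · obtain ⟨δ, hδ, hA⟩ := htail j ⟨w, hw⟩
    exact ⟨b j ⟨w, hw⟩, (hb j ⟨w, hw⟩).1, (hb j ⟨w, hw⟩).2, δ, hδ, hA⟩

/-- `A` consists of nodes of a single height and has order type `χ` below `α`. -/
def IsThinLadder (χ : Cardinal.{u}) (e : κ.ord.ToType → T) (α : κ.ord.ToType)
    (A : Set κ.ord.ToType) : Prop :=
  (∃ ξ, ∀ β ∈ A, treeHeight (e β) = ξ) ∧ ∀ γ < α, #(A ∩ Iio γ : Set κ.ord.ToType) < χ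

theorem exists_thin_ladders_of_not_isLimitOfHeights (h : ¬ IsLimitOfHeights e α) (hχ : ℵ₀ ≤ χ)
    (hα : cof (Iio α) = χ) (hmono : Monotone fun β => treeHeight (e β)) :
    ∃ A : χ.ord.ToType → Set κ.ord.ToType, (∀ j, IsCofinalSubset (A j) α) ∧
      (∀ i j, i ≠ j → Disjoint (A i) (A j)) ∧ ∀ j, IsThinLadder χ e α (A j) := by
  simp only [IsLimitOfHeights, not_forall, not_exists, not_and, not_lt] at h
  obtain ⟨β, hβ, hle⟩ := h
  obtain ⟨A, hcof, hdisj, hsub, hthin⟩ := exists_disjoint_thin_ladders hχ hα hβ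
  refine ⟨A, hcof, hdisj, fun j => ⟨⟨treeHeight (e β), fun γ hγ => ?_⟩, hthin j⟩⟩
  exact (hle γ ((hcof j).1 hγ)).antisymm (hmono (hsub j hγ))

/-- Ladders at distinct points are almost disjoint. -/
theorem exists_bound_inter_ladders (hχ : ℵ₀ ≤ χ) (heinj : Function.Injective e)
    (hmono : Monotone fun β => treeHeight (e β)) {α' : κ.ord.ToType} (hlt : α < α')
    (hα : cof (Iio α) = χ) {A A' : Set κ.ord.ToType} (hA : A ⊆ Iio α)
    (hA1 : IsThinLadder χ e α A ∨ IsCoveredByBranches χ e α A)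
    (hA1' : IsThinLadder χ e α' A' ∨ IsCoveredByBranches χ e α' A') :
    ∃ δ < α, ∀ β ∈ A ∩ A', β < δ := by
  have hsub : A ∩ A' ⊆ Iio α := inter_subset_left.trans hA
  rcases hA1' with hthin' | ⟨hlim', 𝒞', h𝒞', hvan', hcov'⟩
  · refine exists_lt_forall_lt_of_mk_lt_cof hsub ?_
    rw [hα]
    exact (mk_le_mk_of_subset (subset_inter inter_subset_right hsub)).trans_lt (hthin'.2 α hlt)
  -- A branch meets a single level at most once, so a thin ladder meets fewer than χ branches in
  -- fewer than χ points. Two families of branches have different lengths, so all pairs separate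
  -- below α.
  rcases hA1 with ⟨⟨ξ, hξ⟩, -⟩ | ⟨-, 𝒞, h𝒞, hvan, hcov⟩
  · refine exists_lt_forall_lt_of_mk_lt_cof hsub ?_
    rw [hα]
    choose c hc hcβ using fun β : (A ∩ A' : Set _) => hcov' β.1 β.2.2
    refine (mk_le_of_injective (f := fun β => (⟨c β, hc β⟩ : 𝒞')) fun β γ hβγ => ?_).trans_lt h𝒞'
    have hcc : c β = c γ := Subtype.mk.inj hβγ
    refine Subtype.ext (heinj (eq_of_treeHeight_eq
      ((hvan' _ (hc β)).le_or_le (hcβ β) (hcc ▸ hcβ γ)) ?_))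
    rw [hξ _ β.2.1, hξ _ γ.2.1]
  · have hη : limitHeight e α < limitHeight e α' :=
      (ciSup_le' fun β => hmono (le_of_lt β.2)).trans_lt (hlim'.lt_limitHeight hlt)
    have hsep : ∀ p : 𝒞 × 𝒞', ∃ γ < α, ∀ z ∈ p.1.1 ∩ p.2.1, treeHeight z < treeHeight (e γ) := by
      intro p
      have hne : p.1.1 ≠ p.2.1 := by
        intro heq
        obtain ⟨x, hx, hηx⟩ := (hvan' _ p.2.2).exists_treeHeight_ge _ hη
        exact ((hvan _ p.1.2).treeHeight_lt x (heq ▸ hx)).not_ge hηx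
      obtain ⟨x, hx, hxz⟩ := (hvan _ p.1.2).exists_mem_forall_inter (hvan' _ p.2.2) hη.le hne
      obtain ⟨γ, hγ, hxγ⟩ := exists_lt_of_lt_limitHeight ((hvan _ p.1.2).treeHeight_lt x hx)
      exact ⟨γ, hγ, fun z hz => (hxz z hz).trans hxγ⟩
    choose γ hγα hγ using hsep
    obtain ⟨δ, hδ, hδγ⟩ := exists_lt_forall_lt_of_fun hγα (by
      rw [mk_prod, lift_id, lift_id, hα]
      exact mul_lt_of_lt hχ h𝒞 h𝒞')
    refine ⟨δ, hδ, fun β hβ => ?_⟩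
    obtain ⟨c, hc, hβc⟩ := hcov β hβ.1
    obtain ⟨c', hc', hβc'⟩ := hcov' β hβ.2
    exact (hmono.reflect_lt (hγ (⟨c, hc⟩, ⟨c', hc'⟩) _ ⟨hβc, hβc'⟩)).trans (hδγ _)

end Core

/-! ### Guessing and assembly of the principle -/

section Main

variable {κ χ : Cardinal.{u}} {T : Type u} [PartialOrder T] [IsSetTree T] {ι : Type u}

/-- A common guessing function for all members of a stationary partition. -/
theorem IsStationaryPartition.exists_splitting (hκ : κ.IsRegular) (hκ' : ℵ₀ < κ) (hχκ : χ < κ)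
    {𝒮 : Set (Set κ.ord.ToType)} (h𝒮 : IsStationaryPartition 𝒮 (cofSet κ χ)) {I : Type u}
    [Nonempty I] (hI : #I ≤ κ) :
    ∃ G : κ.ord.ToType → I, ∀ S ∈ 𝒮, ∀ i, IsStationary {α | α ∈ S ∧ G α = i} := by
  classical
  have hcof : cof κ.ord.ToType = κ := by rw [Ordinal.cof_toType, hκ.cof_ord]
  have hS : ∀ S : 𝒮, ∃ G : κ.ord.ToType → I, ∀ i, IsStationary {α | α ∈ S.1 ∧ G α = i} :=
    fun S => (h𝒮.stationary S.1 S.2).exists_splitting (by rwa [hcof])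
      (fun a => by rw [hcof]; exact mk_Iio_ordToType_lt a) (χ := χ) (by rwa [hcof])
      (fun α hα => by
        have : α ∈ cofSet κ χ := h𝒮.sUnion_eq ▸ mem_sUnion_of_mem hα S.2
        exact this) (by rwa [hcof])
  choose G hG using hS
  refine ⟨fun α => if h : ∃ S : 𝒮, α ∈ S.1 then G h.choose α else Classical.arbitrary I,
    fun S hS i => (hG ⟨S, hS⟩ i).mono ?_⟩
  rintro α ⟨hαS, hα⟩
  have h : ∃ S : 𝒮, α ∈ S.1 := ⟨⟨S, hS⟩, hαS⟩
  have heq : h.choose = ⟨S, hS⟩ := by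
    by_contra hne
    exact disjoint_left.1 (h𝒮.disjoint h.choose.2 hS fun h' => hne (Subtype.ext h'))
      h.choose_spec hαS
  refine ⟨hαS, ?_⟩
  simp only [dif_pos h, heq]
  exact hα

/-- For a set `B` of `κ` many nodes there is a node `w` such that, on a club, the branches through
`w` meet `B` cofinally. -/
theorem IsSouslinTree.exists_guess (hT : IsSouslinTree κ T) (hκ : κ.IsRegular) (hκ' : ℵ₀ < κ)
    {e : κ.ord.ToType → T} (heinj : Function.Injective e)
    (hmono : Monotone fun β => treeHeight (e β))
    (hunb : ∀ ξ < κ.ord, ∃ γ, ξ < treeHeight (e γ)) {ξ₀ : Ordinal.{u}} (hξ₀ : ξ₀ < κ.ord)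
    {B : Set κ.ord.ToType} (hB : #B = κ) :
    ∃ w, ξ₀ ≤ treeHeight w ∧ ∃ C : Set κ.ord.ToType, IsClub C ∧
      ∀ α ∈ C, IsLimitOfHeights e α ∧ ∀ β₀ < α, treeHeight w < limitHeight e α ∧
        ∀ c, IsVanishingBranch (limitHeight e α) c → w ∈ c → ∃ β ∈ B, β₀ < β ∧ e β ∈ c := by
  have hcof : cof κ.ord.ToType = κ := by rw [Ordinal.cof_toType, hκ.cof_ord]
  have heB : #(e '' B) = κ := by rw [mk_image_eq heinj, hB]
  obtain ⟨w₀, hw₀⟩ := hT.exists_forall_ge_le_mk_inter_Ici hκ heB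
  obtain ⟨w, hww, hwξ⟩ : ∃ w, w₀ ≤ w ∧ ξ₀ ≤ treeHeight w := by
    obtain ⟨w, hw, hwξ⟩ := hT.exists_treeHeight_ge hκ (hw₀ w₀ le_rfl) hξ₀
    exact ⟨w, hw.2, hwξ⟩
  have hnext : ∀ β, ∃ γ, treeHeight w < treeHeight (e γ) ∧ treeHeight (e β) < treeHeight (e γ) ∧
      ∀ b ∈ e '' B, treeHeight (e β) < treeHeight b →
        ∃ a ∈ e '' B, treeHeight (e β) < treeHeight a ∧ treeHeight a < treeHeight (e γ) ∧
          a ≤ b := by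
    -- γ bounds the heights of the minimal elements of B above the height of `e β`, as well as the
    -- heights of w and `e β`.
    intro β
    obtain ⟨ξ, hξ, h⟩ := hT.exists_minimalNodes_bound hκ
      {b | b ∈ e '' B ∧ treeHeight (e β) < treeHeight b}
    obtain ⟨γ, hγ⟩ := hunb (max ξ (max (treeHeight w) (treeHeight (e β))))
      (max_lt hξ (max_lt (hT.treeHeight_lt _) (hT.treeHeight_lt _)))
    simp only [max_lt_iff] at hγ
    refine ⟨γ, hγ.2.1, hγ.2.2, fun b hb hβb => ?_⟩
    obtain ⟨a, ha, haξ, hab⟩ := h b ⟨hb, hβb⟩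
    exact ⟨a, ha.1, ha.2, haξ.trans hγ.1, hab⟩
  choose G hGw hGβ hG using hnext
  refine ⟨w, hwξ, _, isClub_closure_points (by rwa [hcof])
    (fun a => by rw [hcof]; exact mk_Iio_ordToType_lt a) G, fun α hα => ?_⟩
  have hlim : IsLimitOfHeights e α := fun β hβ => ⟨G β, hα β hβ, hGβ β⟩
  refine ⟨hlim, fun β₀ hβ₀ => ⟨(hGw β₀).trans (hlim.lt_limitHeight (hα _ hβ₀)),
    fun c hc hwc => ?_⟩⟩
  -- Some b in B lies above x, as x ≥ w. Below b there is an element a of B higher than `e β₀` but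
  -- lower than x; being comparable with x, it lies on the branch.
  obtain ⟨x, hxc, hx⟩ := hc.exists_treeHeight_ge _ (hlim.lt_limitHeight (hα _ hβ₀))
  have hwx : w ≤ x := le_of_treeHeight_le (hc.le_or_le hwc hxc) ((hGw β₀).le.trans hx)
  obtain ⟨b, ⟨hb, hxb⟩, -⟩ := hT.exists_treeHeight_ge hκ (hw₀ x (hww.trans hwx))
    (hT.treeHeight_lt w)
  obtain ⟨a, ⟨β, hβB, rfl⟩, hβa, haγ, hab⟩ := hG β₀ b hb
    (((hGβ β₀).trans_le hx).trans_le (treeHeight_strictMono.monotone hxb))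
  refine ⟨β, hβB, hmono.reflect_lt hβa, hc.isLowerSet ?_ hxc⟩
  exact le_of_treeHeight_le (le_or_le_of_le_of_le hab hxb) (haγ.le.trans hx)

/-- The common core of both cases: completeness and regressivity enter only through the existence of
vanishing branches and the count of small sets of nodes. -/
theorem IsSouslinTree.clubAD (hT : IsSouslinTree κ T) (hκ : κ.IsRegular) (hκ' : ℵ₀ < κ)
    (hχ : ℵ₀ ≤ χ) (hχκ : χ < κ) [Nontrivial ι] (hι : #ι < κ) {ξ₀ : Ordinal.{u}}
    (hξ₀ : ξ₀ < κ.ord) {g : T → ι → T} (hg : IsSplitting ξ₀ g)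
    (hvan : ∀ η < κ.ord, IsClosedLevel ξ₀ g η → η.cof = χ →
      ∀ w : T, ξ₀ ≤ treeHeight w → treeHeight w < η → ∃ c, IsVanishingBranch η c ∧ w ∈ c)
    (hcount : #{W : Set T // #W < χ} ≤ κ) {𝒮 : Set (Set κ.ord.ToType)}
    (h𝒮 : IsStationaryPartition 𝒮 (cofSet κ χ)) : ClubAD κ 𝒮 χ := by
  classical
  have hcof : cof κ.ord.ToType = κ := by rw [Ordinal.cof_toType, hκ.cof_ord]
  have hcl := fun ξ (hξ : ξ < κ.ord) => hT.exists_isClosedLevel hκ hκ' hι hξ₀ g hξ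
  obtain ⟨e, heinj, he, hmono⟩ := hT.exists_enumeration hκ (L := {η | IsClosedLevel ξ₀ g η}) hcl
  have hunb : ∀ ξ < κ.ord, ∃ γ, ξ < treeHeight (e γ) := by
    intro ξ hξ
    obtain ⟨η, hη, hξη, hηcl⟩ := hcl ξ hξ
    obtain ⟨x, -, hx⟩ := hT.exists_treeHeight_ge hκ (s := univ)
      (by rw [mk_univ]; exact hT.card_eq.ge) hη
    obtain ⟨y, -, hy⟩ := exists_le_treeHeight_eq hx
    obtain ⟨γ, rfl⟩ := (he y).2 (hy ▸ hηcl)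
    exact ⟨γ, hy ▸ hξη⟩
  have : Nonempty {W : Set T // #W < χ} :=
    ⟨⟨∅, by rw [mk_eq_zero]; exact aleph0_pos.trans_le hχ⟩⟩
  obtain ⟨G, hG⟩ := h𝒮.exists_splitting hκ hκ' hχκ hcount
  have hexlt : ∀ α : κ.ord.ToType, cof (Iio α) = χ → ∃ β, β < α :=
    fun α hα => Iio_nonempty_of_aleph0_le_cof (hα ▸ hχ)
  have hlad : ∀ α, ∃ A : χ.ord.ToType → Set κ.ord.ToType, cof (Iio α) = χ →
      (∀ j, IsCofinalSubset (A j) α) ∧ (∀ i j, i ≠ j → Disjoint (A i) (A j)) ∧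
      (∀ j, IsThinLadder χ e α (A j) ∨ IsCoveredByBranches χ e α (A j)) ∧
      (IsLimitOfHeights e α → ∀ j, ∀ w ∈ (G α).1, ξ₀ ≤ treeHeight w →
        treeHeight w < limitHeight e α → ∃ c, IsVanishingBranch (limitHeight e α) c ∧ w ∈ c ∧
          ∃ δ < α, ∀ β, δ ≤ β → e β ∈ c → β ∈ A j) := by
    intro α
    by_cases hα : cof (Iio α) = χ
    swap
    · exact ⟨fun _ => ∅, fun h => absurd h hα⟩
    by_cases hlim : IsLimitOfHeights e α
    · obtain ⟨β, hβ⟩ := hexlt α hα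
      have hηcl : IsClosedLevel ξ₀ g (limitHeight e α) :=
        hlim.isClosedLevel (fun β => (he (e β)).1 ⟨β, rfl⟩) ⟨β, hβ⟩
      -- Adding `e β` keeps W nonempty, so that the ladders are cofinal even when the guess has no
      -- suitable node.
      let W : Set T :=
        insert (e β) {w | w ∈ (G α).1 ∧ ξ₀ ≤ treeHeight w ∧ treeHeight w < limitHeight e α}
      have hW : ∀ w ∈ W, ξ₀ ≤ treeHeight w ∧ treeHeight w < limitHeight e α := by
        rintro w (rfl | hw)
        · exact ⟨((he (e β)).1 ⟨β, rfl⟩).1, hlim.lt_limitHeight hβ⟩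
        · exact hw.2
      have hWχ : #W < χ := mk_insert_le.trans_lt (add_lt_of_lt hχ
        ((mk_le_mk_of_subset fun w hw => hw.1).trans_lt (G α).2) (one_lt_aleph0.trans_le hχ))
      obtain ⟨A, h1, h2, h3, h4⟩ := hlim.exists_ladders hχ hα hmono hg he
        (hvan _ (limitHeight_lt hκ hT) hηcl (hlim.cof_limitHeight hmono hα)) hW hWχ
        ⟨_, mem_insert _ _⟩
      exact ⟨A, fun _ => ⟨h1, h2, fun j => Or.inr (h3 j),
        fun _ j w hw hwξ hwη => h4 j w (mem_insert_of_mem _ ⟨hw, hwξ, hwη⟩)⟩⟩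
    · obtain ⟨A, h1, h2, h3⟩ := exists_thin_ladders_of_not_isLimitOfHeights hlim hχ hα hmono
      exact ⟨A, fun _ => ⟨h1, h2, fun j => Or.inl (h3 j), fun h => absurd h hlim⟩⟩
  choose A hA using hlad
  have hE : ∀ α ∈ ⋃₀ 𝒮, cof (Iio α) = χ := by
    intro α hα
    rw [h𝒮.sUnion_eq] at hα
    exact hα
  have hsup : ∀ α : κ.ord.ToType, cof (Iio α) = χ → ∀ j, ∀ δ < α, ∃ y ∈ A α j, δ < y := by
    intro α hα j δ hδ
    obtain ⟨γ, hδγ, hγ⟩ := exists_between_of_aleph0_le_cof (hα ▸ hχ) hδ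
    obtain ⟨y, hy, hγy⟩ := ((hA α hα).1 j).2 γ hγ
    exact ⟨y, hy, hδγ.trans_le hγy⟩
  have hne : Nonempty χ.ord.ToType := by
    rw [← mk_ne_zero_iff, mk_ord_toType]
    exact (aleph0_pos.trans_le hχ).ne'
  refine ⟨fun α => range (A α), ⟨?_, ?_, ?_, ?_⟩, ?_, ?_⟩
  · exact fun α _ _ => range_nonempty _
  · rintro α hα - _ ⟨j, rfl⟩
    exact (hA α (hE α hα)).1 j
  · rintro α hα - _ ⟨i, rfl⟩ _ ⟨j, rfl⟩ hij
    exact (hA α (hE α hα)).2.1 i j fun h => hij (by rw [h])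
  · intro B hB B' hB' hBB'
    simp only [mem_iUnion, mem_range, exists_prop] at hB hB'
    obtain ⟨α, hα, i, rfl⟩ := hB
    obtain ⟨α', hα', j, rfl⟩ := hB'
    have hαχ := hE α hα
    have hαχ' := hE α' hα'
    obtain ⟨δ, hδ, hbd⟩ : ∃ δ < α, ∀ β ∈ A α i ∩ A α' j, β ≤ δ := by
      rcases lt_trichotomy α α' with hlt | rfl | hlt
      · obtain ⟨δ, hδ, h⟩ := exists_bound_inter_ladders hχ heinj hmono hlt hαχ
          ((hA α hαχ).1 i).1 ((hA α hαχ).2.2.1 i) ((hA α' hαχ').2.2.1 j)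
        exact ⟨δ, hδ, fun β hβ => (h β hβ).le⟩
      · obtain ⟨δ, hδ⟩ := hexlt α hαχ
        have hd := (hA α hαχ).2.1 i j fun h => hBB' (by rw [h])
        exact ⟨δ, hδ, fun β hβ => absurd hβ.2 (disjoint_left.1 hd hβ.1)⟩
      · exact ⟨α', hlt, fun β hβ => (((hA α' hαχ').1 j).1 hβ.2).le⟩
    obtain ⟨y, hy, hδy⟩ := hsup α hαχ i δ hδ
    exact ⟨δ, fun β hβ => hbd β hβ, y, hy, hδy⟩
  · intro α hα
    have hαχ := hE α hα
    have hinj : Function.Injective (A α) := by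
      intro i j hij
      by_contra hne'
      have hd := (hA α hαχ).2.1 i j hne'
      obtain ⟨δ, hδ⟩ := hexlt α hαχ
      obtain ⟨y, hy, -⟩ := hsup α hαχ i δ hδ
      exact disjoint_left.1 hd hy (hij ▸ hy)
    rw [mk_range_eq _ hinj, mk_ord_toType, hαχ]
  · intro ℬ hℬ hℬχ S hS
    choose w hwξ C hC hwC using fun B : ℬ =>
      hT.exists_guess hκ hκ' heinj hmono hunb hξ₀ (hℬ B.1 B.2)
    -- One node per member of ℬ; the stationarily many α with `G α = W` have ladders following
    -- branches through all of them.
    let W : {W : Set T // #W < χ} := ⟨range w, mk_range_le.trans_lt hℬχ⟩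
    have hClub : IsClub (⋂ B, C B) := IsClub.iInter (by rw [hcof]; exact hκ'.ne')
      (by simpa [hcof, hκ.cof_ord] using hℬχ.trans hχκ) hC
    refine ((hG S hS W).inter_isClub (by rwa [hcof]) hClub).mono ?_
    rintro α ⟨⟨hαS, hGα⟩, hαC⟩
    refine ⟨hαS, ?_⟩
    rintro _ ⟨j, rfl⟩ B hB
    have hαχ := hE α (mem_sUnion_of_mem hαS hS)
    obtain ⟨hlim, hguess⟩ := hwC ⟨B, hB⟩ α (mem_iInter.1 hαC _)
    obtain ⟨β₀, hβ₀⟩ := hexlt α hαχ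
    obtain ⟨c, hc, hwc, δ, hδ, hδA⟩ := (hA α hαχ).2.2.2 hlim j (w ⟨B, hB⟩)
      (by rw [hGα]; exact ⟨_, rfl⟩) (hwξ _) (hguess β₀ hβ₀).1
    refine ⟨fun β hβ => (((hA α hαχ).1 j).1 hβ.1).le, fun b hb => le_of_not_gt fun hbα => ?_⟩
    obtain ⟨β, hβB, hlt, hβc⟩ := (hguess (max b δ) (max_lt hbα hδ)).2 c hc hwc
    have hβA := hδA β ((le_max_right _ _).trans hlt.le) hβc
    exact (hb ⟨hβA, hβB⟩).not_gt ((le_max_left _ _).trans_lt hlt)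

end Main

theorem theoremA :
    (∀ lam : Cardinal.{u}, ℵ₀ ≤ lam →
      (∃ (T : Type u) (_ : PartialOrder T) (_ : IsSetTree T),
        IsSouslinTree (Order.succ lam) T ∧ IsCompleteTree lam.ord.cof T) →
      ∀ 𝒮 : Set (Set (Order.succ lam).ord.ToType),
        IsStationaryPartition 𝒮 (cofSet (Order.succ lam) lam.ord.cof) →
        ClubAD (Order.succ lam) 𝒮 lam.ord.cof) ∧
    (∀ κ : Cardinal.{u}, κ.IsRegular → ℵ₀ < κ →
      (∃ (T : Type u) (_ : PartialOrder T) (_ : IsSetTree T),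
        IsSouslinTree κ T ∧ IsRegressiveTree T) →
      ∀ 𝒮 : Set (Set κ.ord.ToType),
        IsStationaryPartition 𝒮 (cofSet κ ℵ₀) →
        ClubAD κ 𝒮 ℵ₀) := by
  constructor
  · rintro lam hlam ⟨T, _, _, hT, hc⟩ 𝒮 h𝒮
    have hκ := isRegular_succ hlam
    have hκ' : ℵ₀ < succ lam := hlam.trans_lt (lt_succ lam)
    have hχ : lam.ord.cof.IsRegular := isRegular_cof (isSuccLimit_ord hlam)
    have hχκ : lam.ord.cof < succ lam := (Ordinal.cof_ord_le lam).trans_lt (lt_succ lam)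
    obtain ⟨ξ₀, hξ₀, hbig⟩ := hT.exists_forall_le_mk_Ici hκ
    obtain ⟨g, hg⟩ := exists_isSplitting fun x hx => hT.exists_antichain_above hlam hξ₀ hbig hx
    obtain ⟨r, -, hr⟩ := hT.exists_treeHeight_ge hκ (s := univ)
      (by rw [mk_univ]; exact hT.card_eq.ge) hξ₀
    have : Nontrivial lam.ord.ToType := by
      rw [← one_lt_iff_nontrivial, mk_ord_toType]
      exact one_lt_aleph0.trans_le hlam
    exact hT.clubAD hκ hκ' hχ.aleph0_le hχκ (by rw [mk_ord_toType]; exact lt_succ lam) hξ₀ hg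
      (fun η hη hηcl hηcof w hwξ hwη => hT.exists_isVanishingBranch_of_isCompleteTree hlam hc hbig
        hg hη hηcl hηcof hwξ hwη)
      (hT.mk_small_sets_le hlam hc hg hr) h𝒮
  · rintro κ hκ hκ' ⟨T, _, _, hT, hρ⟩ 𝒮 h𝒮
    obtain ⟨ξ₀, hξ₀, hbig⟩ := hT.exists_forall_le_mk_Ici hκ
    obtain ⟨g, hg⟩ := exists_isSplitting fun x hx => hT.exists_incomparable_above (hbig x hx)
    have : Nonempty T := by
      rw [← mk_ne_zero_iff, hT.card_eq]
      exact hκ.ne_zero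
    exact hT.clubAD hκ hκ' le_rfl hκ' (lt_of_lt_of_le (by simp) hκ'.le) hξ₀ hg
      (fun η hη hηcl hηcof w hwξ hwη => hT.exists_isVanishingBranch_of_isRegressiveTree hκ
        isCompleteTree_aleph0 hρ hbig hg hη hηcl hηcof hwξ hwη)
      (mk_finite_sets_le hT.card_eq hκ.aleph0_le) h𝒮
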